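/- Let $\mathbb{H}(\mathbb{C})$ be the algebra of quaternions over $\mathbb{C}$ with units $1,I,J,K$, and put $e_1=\frac12(1+iI)$, $e_2=\frac12(1-iI)$, $e_3=\frac12(iJ-K)$, $e_4=\frac12(iJ+K)$; these form a basis over $\mathbb{C}$. Use the norm $\|\sum_k a_ke_k\|=\sqrt{\sum_k|a_k|^2}$. Let $$\mathcal I_2=\{\lambda_1e_1+\lambda_3e_3:\lambda_1,\lambda_3\in\mathbb C\},\qquad \widehat{\mathcal I}_2=\{\lambda_1e_1+\lambda_4e_4:\lambda_1,\lambda_4\in\mathbb C\},$$ and let $f_1,f_2:\mathbb{H}(\mathbb{C})\to\mathbb{C}$ be the $\mathbb C$-linear functionals with $f_1(e_1)=f_1(e_3)=1$, $f_1(e_2)=f_1(e_4)=0$, $f_2(e_2)=f_2(e_4)=1$, $f_2(e_1)=f_2(e_3)=0$. Let $a_1,a_2,b_1,b_2\in\mathbb{C}$ be such that $i_1=1$, $i_2=a_1e_1+a_2e_2$, $i_3=b_1e_1+b_2e_2$ are linearly independent over $\mathbb{R}$, and let $E_3$ be their real linear span. Let $\Omega\subset\mathbb{R}^3$ be a domain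 (a nonempty connected open set), $\Omega_\zeta=\{xi_1+yi_2+zi_3:(x,y,z)\in\Omega\}$ and $D_1=f_1(\Omega_\zeta)$; for $\zeta=xi_1+yi_2+zi_3$ write $\xi_1=f_1(\zeta)=x+ya_1+zb_1$. A continuous map $\Phi:\Omega_\zeta\to\mathbb{H}(\mathbb{C})$ is called right-$G$-monogenic (respectively left-$G$-monogenic) if for every $\zeta\in\Omega_\zeta$ there is an element $\Phi'(\zeta)\in\mathbb{H}(\mathbb{C})$ such that for all $h\in E_3$ $$\lim_{\varepsilon\to0+}\bigl(\Phi(\zeta+\varepsilon h)-\Phi(\zeta)\bigr)\varepsilon^{-1}=h\,\Phi'(\zeta)\qquad(\text{respectively } =\Phi'(\zeta)\,h).$$ Suppose that $f_1(E_3)=f_2(E_3)=\mathbb{C}$ and that $\Omega$ is convex in the direction of the line $$L_1:\; x+y\,\mathrm{Re}\,a_1+z\,\mathrm{Re}\,b_1=0,\quad y\,\mathrm{Im}\,a_1+z\,\mathrm{Im}\,b_1=0,$$ i.e. $\Omega$ contains every segment that is parallel to $L_1$ and joins two points of $\Omega$. Then: 1. for every right-$G$-monogenic map $\Phi_{20}:\Omega_\zeta\to\mathcal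 I_2$ there are functions $F_{21},F_{23}$, analytic in $D_1$, such that $\Phi_{20}(\zeta)=F_{21}(\xi_1)e_1+F_{23}(\xi_1)e_3$ for all $\zeta\in\Omega_\zeta$; 2. for every left-$G$-monogenic map $\widehat\Phi_{20}:\Omega_\zeta\to\widehat{\mathcal I}_2$ there are functions $F_{22},F_{24}$, analytic in $D_1$, such that $\widehat\Phi_{20}(\zeta)=F_{22}(\xi_1)e_1+F_{24}(\xi_1)e_4$ for all $\zeta\in\Omega_\zeta$. -/

import Mathlib

open Set Filter Topology

namespace GMonogenic

noncomputable section

/-- The algebra of complex quaternions, with units `1, I, J, K` given by the four coordinates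
`re, imI, imJ, imK`. -/
abbrev HC : Type := Quaternion ℂ

/-- `e₁ = (1 + iI) / 2`. -/
def e₁ : HC := ⟨1 / 2, Complex.I / 2, 0, 0⟩

/-- `e₂ = (1 - iI) / 2`. -/
def e₂ : HC := ⟨1 / 2, -(Complex.I / 2), 0, 0⟩

/-- `e₃ = (iJ - K) / 2`. -/
def e₃ : HC := ⟨0, 0, Complex.I / 2, -(1 / 2)⟩

/-- `e₄ = (iJ + K) / 2`. -/
def e₄ : HC := ⟨0, 0, Complex.I / 2, 1 / 2⟩

@[simp] theorem e₁_re : e₁.re = 1 / 2 := rfl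
@[simp] theorem e₁_imI : e₁.imI = Complex.I / 2 := rfl
@[simp] theorem e₁_imJ : e₁.imJ = 0 := rfl
@[simp] theorem e₁_imK : e₁.imK = 0 := rfl

@[simp] theorem e₂_re : e₂.re = 1 / 2 := rfl
@[simp] theorem e₂_imI : e₂.imI = -(Complex.I / 2) := rfl
@[simp] theorem e₂_imJ : e₂.imJ = 0 := rfl
@[simp] theorem e₂_imK : e₂.imK = 0 := rfl

@[simp] theorem e₃_re : e₃.re = 0 := rfl
@[simp] theorem e₃_imI : e₃.imI = 0 := rfl
@[simp] theorem e₃_imJ : e₃.imJ = Complex.I / 2 := rfl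
@[simp] theorem e₃_imK : e₃.imK = -(1 / 2) := rfl

@[simp] theorem e₄_re : e₄.re = 0 := rfl
@[simp] theorem e₄_imI : e₄.imI = 0 := rfl
@[simp] theorem e₄_imJ : e₄.imJ = Complex.I / 2 := rfl
@[simp] theorem e₄_imK : e₄.imK = 1 / 2 := rfl

/-- The coordinates `(a₁, a₂, a₃, a₄)` of `a = a₁ e₁ + a₂ e₂ + a₃ e₃ + a₄ e₄`. The inverse map sends
a coordinate vector to this linear combination, so that `e₁, e₂, e₃, e₄` is a basis over `ℂ`. -/
def coord : HC ≃ₗ[ℂ] (Fin 4 → ℂ) where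
  toFun a := ![a.re - Complex.I * a.imI, a.re + Complex.I * a.imI,
    -(Complex.I * a.imJ) - a.imK, -(Complex.I * a.imJ) + a.imK]
  map_add' a b := by
    funext k
    fin_cases k <;> simp <;> ring
  map_smul' c a := by
    funext k
    fin_cases k <;> simp <;> ring
  invFun c := c 0 • e₁ + c 1 • e₂ + c 2 • e₃ + c 3 • e₄
  left_inv a := by
    have hI : Complex.I * Complex.I = -1 := Complex.I_mul_I
    ext1 <;> simp
    · ring
    · linear_combination (-a.imI) * hI
    · linear_combination (-a.imJ) * hI
    · ring
  right_inv c := by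
    have hI : Complex.I * Complex.I = -1 := Complex.I_mul_I
    funext k
    fin_cases k <;> simp
    · linear_combination (-(c 0 - c 1) / 2) * hI
    · linear_combination ((c 0 - c 1) / 2) * hI
    · linear_combination (-(c 2 + c 3) / 2) * hI
    · linear_combination (-(c 2 + c 3) / 2) * hI

/-- The coordinates in the basis `e₁, e₂, e₃, e₄` as a vector of the Hermitian space `ℂ⁴`. -/
def coordHom : HC →+ EuclideanSpace ℂ (Fin 4) where
  toFun a := WithLp.toLp 2 (coord a)
  map_zero' := by simp
  map_add' a b := by simp

/-- The algebra of complex quaternions carries the norm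
`‖a‖ = √(|a₁|² + |a₂|² + |a₃|² + |a₄|²)` of the coordinates in the basis `e₁, e₂, e₃, e₄`. -/
instance : NormedAddCommGroup HC :=
  NormedAddCommGroup.induced HC (EuclideanSpace ℂ (Fin 4)) coordHom (fun _ _ h =>
    coord.injective (congrArg WithLp.ofLp h))

theorem norm_eq (a : HC) : ‖a‖ = √(∑ k, ‖coord a k‖ ^ 2) :=
  EuclideanSpace.norm_eq (coordHom a)

/-- The linear functional with `f₁(e₁) = f₁(e₃) = 1` and `f₁(e₂) = f₁(e₄) = 0`. -/
def f₁ : HC →ₗ[ℂ] ℂ :=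
  (LinearMap.proj (R := ℂ) (φ := fun _ : Fin 4 => ℂ) 0 + LinearMap.proj 2) ∘ₗ coord.toLinearMap

/-- The linear functional with `f₂(e₂) = f₂(e₄) = 1` and `f₂(e₁) = f₂(e₃) = 0`. -/
def f₂ : HC →ₗ[ℂ] ℂ :=
  (LinearMap.proj (R := ℂ) (φ := fun _ : Fin 4 => ℂ) 1 + LinearMap.proj 3) ∘ₗ coord.toLinearMap

theorem f₁_apply (c₁ c₂ c₃ c₄ : ℂ) :
    f₁ (c₁ • e₁ + c₂ • e₂ + c₃ • e₃ + c₄ • e₄) = c₁ + c₃ := by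
  have h := coord.apply_symm_apply ![c₁, c₂, c₃, c₄]
  change coord (c₁ • e₁ + c₂ • e₂ + c₃ • e₃ + c₄ • e₄) = _ at h
  simp only [f₁, LinearMap.comp_apply, LinearEquiv.coe_coe, h]
  simp

theorem f₂_apply (c₁ c₂ c₃ c₄ : ℂ) :
    f₂ (c₁ • e₁ + c₂ • e₂ + c₃ • e₃ + c₄ • e₄) = c₂ + c₄ := by
  have h := coord.apply_symm_apply ![c₁, c₂, c₃, c₄]
  change coord (c₁ • e₁ + c₂ • e₂ + c₃ • e₃ + c₄ • e₄) = _ at h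
  simp only [f₂, LinearMap.comp_apply, LinearEquiv.coe_coe, h]
  simp

/-- The maximal right ideal `I₂ = {λ₁ e₁ + λ₃ e₃}`. -/
def idealI₂ : Set HC := {a | ∃ l₁ l₃ : ℂ, a = l₁ • e₁ + l₃ • e₃}

/-- The maximal left ideal `Î₂ = {λ₁ e₁ + λ₄ e₄}`. -/
def idealHatI₂ : Set HC := {a | ∃ l₁ l₄ : ℂ, a = l₁ • e₁ + l₄ • e₄}

/-- The triple `i₁ = 1`, `i₂ = a₁ e₁ + a₂ e₂`, `i₃ = b₁ e₁ + b₂ e₂`. -/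
def triple (a₁ a₂ b₁ b₂ : ℂ) : Fin 3 → HC :=
  ![1, a₁ • e₁ + a₂ • e₂, b₁ • e₁ + b₂ • e₂]

/-- The map `(x, y, z) ↦ ζ = x i₁ + y i₂ + z i₃` from `ℝ³` to the complex quaternions. -/
def zeta (a₁ a₂ b₁ b₂ : ℂ) (p : EuclideanSpace ℝ (Fin 3)) : HC :=
  ∑ k, p k • triple a₁ a₂ b₁ b₂ k

/-- The real linear span `E₃` of `i₁, i₂, i₃`. -/
def E₃ (a₁ a₂ b₁ b₂ : ℂ) : Submodule ℝ HC :=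
  Submodule.span ℝ (Set.range (triple a₁ a₂ b₁ b₂))

/-- The set `Ω_ζ = {x i₁ + y i₂ + z i₃ : (x, y, z) ∈ Ω}`. -/
def domainZeta (a₁ a₂ b₁ b₂ : ℂ) (Ω : Set (EuclideanSpace ℝ (Fin 3))) : Set HC :=
  zeta a₁ a₂ b₁ b₂ '' Ω

/-- The line `L₁` through the origin of `ℝ³`:
`x + y Re a₁ + z Re b₁ = 0`, `y Im a₁ + z Im b₁ = 0`. -/
def lineL₁ (a₁ b₁ : ℂ) : Submodule ℝ (EuclideanSpace ℝ (Fin 3)) where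
  carrier := {p | p 0 + p 1 * a₁.re + p 2 * b₁.re = 0 ∧ p 1 * a₁.im + p 2 * b₁.im = 0}
  zero_mem' := by simp
  add_mem' := by
    rintro p q ⟨h1, h2⟩ ⟨h3, h4⟩
    refine ⟨?_, ?_⟩
    · simp only [PiLp.add_apply]
      linear_combination h1 + h3
    · simp only [PiLp.add_apply]
      linear_combination h2 + h4
  smul_mem' := by
    rintro c p ⟨h1, h2⟩
    refine ⟨?_, ?_⟩
    · simp only [PiLp.smul_apply, smul_eq_mul]
      linear_combination c * h1
    · simp only [PiLp.smul_apply, smul_eq_mul]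
      linear_combination c * h2

/-- `Ω` is convex in the direction of the line `L` through the origin: it contains every segment
that is parallel to `L` and joins two points of `Ω`. -/
def ConvexInDirection (Ω : Set (EuclideanSpace ℝ (Fin 3)))
    (L : Submodule ℝ (EuclideanSpace ℝ (Fin 3))) : Prop :=
  ∀ p ∈ Ω, ∀ q ∈ Ω, q - p ∈ L → segment ℝ p q ⊆ Ω

/-- `Φ` is right-`G`-monogenic on the subset `S` of `E`: it is continuous on `S`, and at every point
`ζ` of `S` there is an element `Φ'(ζ)` such that for every `h ∈ E` the quotient
`(Φ(ζ + ε h) - Φ(ζ)) / ε` tends to `h Φ'(ζ)` as `ε → 0+`. It is used for sets `S` that are open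
in `E`, and there it depends only on the values of `Φ` on `S`. -/
def RightGMonogenicOn (E : Submodule ℝ HC) (Φ : HC → HC) (S : Set HC) : Prop :=
  ContinuousOn Φ S ∧ ∀ ζ ∈ S, ∃ Φ' : HC, ∀ h ∈ E,
    Tendsto (fun ε : ℝ => ε⁻¹ • (Φ (ζ + ε • h) - Φ ζ)) (𝓝[>] 0) (𝓝 (h * Φ'))

/-- `Φ` is left-`G`-monogenic on the subset `S` of `E`: as above, with the limit `Φ'(ζ) h`. -/
def LeftGMonogenicOn (E : Submodule ℝ HC) (Φ : HC → HC) (S : Set HC) : Prop :=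
  ContinuousOn Φ S ∧ ∀ ζ ∈ S, ∃ Φ' : HC, ∀ h ∈ E,
    Tendsto (fun ε : ℝ => ε⁻¹ • (Φ (ζ + ε • h) - Φ ζ)) (𝓝[>] 0) (𝓝 (Φ' * h))

end

end GMonogenic

open GMonogenic

/-! In the basis `e₁, e₂, e₃, e₄` the algebra is that of the 2 × 2 matrices with rows `(c₁, c₃)` and
`(c₄, c₂)`, and `E₃` consists of diagonal matrices with first entry `f₁ h`. Multiplication by `h` on
the left scales the first row by `f₁ h`; on the right it scales the first column. So each of the two
components `g` of `Φ` has one-sided directional derivatives `f₁ h * k`, with `k` independent of `h`.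
They vanish along `L₁`, the kernel of `ξ₁`, so convexity in that direction makes `g` constant on the
fibres of `ξ₁`, that is, `g = F ∘ ξ₁` (`exists_analyticOnNhd_comp`). Here `F` is continuous and, by
comparison of `h` with `-h`, has partial derivatives that satisfy the Cauchy-Riemann equations
everywhere.

The limits are not uniform in `h`, so real differentiability of `F` is not at hand, and holomorphy
is the Looman-Menchoff theorem. On the closed set where holomorphy fails, Baire's theorem gives a
portion `K` with increments at most `n * |t|` along the axis-parallel lines through its points. A
boundary integral over a rectangle of size `s` is then `O(s ^ 2)`: shrink the rectangle until every
side meets `K` (`Portion.exists_hull`) and compare with values on `K`. Moreover `f` is Lipschitz on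
`K`, so almost every point of `K` is a density point at which `f` is differentiable within `K`.
There the Cauchy-Riemann equations force this derivative to be complex linear, and the integral is
`o(s ^ 2)` (`Portion.rectInt_isLittleO`). Bisection adds up these local bounds, with an open set of
small measure around the null set of bad points. All the integrals vanish, and Morera's theorem
contradicts the choice of `K`. -/

namespace LoomanMenchoff

open MeasureTheory Complex

/-! ### Boundary integrals over rectangles. -/

/-- The integral of `f` over the boundary of the rectangle `[a, b] × [c, d]`. -/
noncomputable def rectInt (f : ℂ → ℂ) (a b c d : ℝ) : ℂ :=
  (∫ x : ℝ in a..b, f (x + c * I)) - (∫ x : ℝ in a..b, f (x + d * I)) +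
    I • (∫ y : ℝ in c..d, f (b + y * I)) - I • (∫ y : ℝ in c..d, f (a + y * I))

theorem rectInt_swap_re (f : ℂ → ℂ) (a b c d : ℝ) : rectInt f b a c d = -rectInt f a b c d := by
  simp only [rectInt, intervalIntegral.integral_symm a b]
  ring

theorem rectInt_swap_im (f : ℂ → ℂ) (a b c d : ℝ) : rectInt f a b d c = -rectInt f a b c d := by
  simp only [rectInt, intervalIntegral.integral_symm c d, smul_eq_mul]
  ring

theorem mk_mem_reProdIm {s t : Set ℝ} {x y : ℝ} :
    (x + y * I : ℂ) ∈ s ×ℂ t ↔ x ∈ s ∧ y ∈ t := by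
  simp [mem_reProdIm]

variable {f : ℂ → ℂ} {a b c d : ℝ}

theorem intervalIntegrable_horizontal {s t : Set ℝ} (hf : ContinuousOn f (s ×ℂ t)) {y : ℝ}
    (hy : y ∈ t) (hs : uIcc a b ⊆ s) :
    IntervalIntegrable (fun x : ℝ => f (x + y * I)) volume a b := by
  apply ContinuousOn.intervalIntegrable
  refine hf.comp (by fun_prop) fun x hx => mk_mem_reProdIm.2 ⟨hs hx, hy⟩

theorem intervalIntegrable_vertical {s t : Set ℝ} (hf : ContinuousOn f (s ×ℂ t)) {x : ℝ}
    (hx : x ∈ s) (ht : uIcc c d ⊆ t) :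
    IntervalIntegrable (fun y : ℝ => f (x + y * I)) volume c d := by
  apply ContinuousOn.intervalIntegrable
  refine hf.comp (by fun_prop) fun y hy => mk_mem_reProdIm.2 ⟨hx, ht hy⟩

theorem rectInt_add_re (hf : ContinuousOn f (Icc a b ×ℂ Icc c d)) (hcd : c ≤ d) {m : ℝ}
    (hm : m ∈ Icc a b) : rectInt f a b c d = rectInt f a m c d + rectInt f m b c d := by
  have h (y : ℝ) (hy : y ∈ Icc c d) :
      (∫ x : ℝ in a..b, f (x + y * I)) =
        (∫ x : ℝ in a..m, f (x + y * I)) + ∫ x : ℝ in m..b, f (x + y * I) := by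
    refine (intervalIntegral.integral_add_adjacent_intervals ?_ ?_).symm
    · exact intervalIntegrable_horizontal hf hy
        (by rw [uIcc_of_le hm.1]; exact Icc_subset_Icc_right hm.2)
    · exact intervalIntegrable_horizontal hf hy
        (by rw [uIcc_of_le hm.2]; exact Icc_subset_Icc_left hm.1)
  simp only [rectInt, h c (left_mem_Icc.2 hcd), h d (right_mem_Icc.2 hcd)]
  ring

theorem rectInt_add_im (hf : ContinuousOn f (Icc a b ×ℂ Icc c d)) (hab : a ≤ b) {m : ℝ}
    (hm : m ∈ Icc c d) : rectInt f a b c d = rectInt f a b c m + rectInt f a b m d := by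
  have h (x : ℝ) (hx : x ∈ Icc a b) :
      (∫ y : ℝ in c..d, f (x + y * I)) =
        (∫ y : ℝ in c..m, f (x + y * I)) + ∫ y : ℝ in m..d, f (x + y * I) := by
    refine (intervalIntegral.integral_add_adjacent_intervals ?_ ?_).symm
    · exact intervalIntegrable_vertical hf hx
        (by rw [uIcc_of_le hm.1]; exact Icc_subset_Icc_right hm.2)
    · exact intervalIntegrable_vertical hf hx
        (by rw [uIcc_of_le hm.2]; exact Icc_subset_Icc_left hm.1)
  simp only [rectInt, h a (left_mem_Icc.2 hab), h b (right_mem_Icc.2 hab), smul_eq_mul]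
  ring

theorem norm_rectInt_le {L₁ L₂ L₃ L₄ : ℝ}
    (h₁ : ‖∫ x : ℝ in a..b, f (x + c * I)‖ ≤ L₁) (h₂ : ‖∫ x : ℝ in a..b, f (x + d * I)‖ ≤ L₂)
    (h₃ : ‖∫ y : ℝ in c..d, f (b + y * I)‖ ≤ L₃) (h₄ : ‖∫ y : ℝ in c..d, f (a + y * I)‖ ≤ L₄) :
    ‖rectInt f a b c d‖ ≤ L₁ + L₂ + L₃ + L₄ := by
  rw [rectInt]
  refine (norm_sub_le _ _).trans (add_le_add ((norm_add_le _ _).trans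
    (add_le_add ((norm_sub_le _ _).trans (add_le_add h₁ h₂)) ?_)) ?_)
  · simpa [norm_smul] using h₃
  · simpa [norm_smul] using h₄

theorem rectInt_sub {g : ℂ → ℂ} (hf : ContinuousOn f (Icc a b ×ℂ Icc c d))
    (hg : ContinuousOn g (Icc a b ×ℂ Icc c d)) (hab : a ≤ b) (hcd : c ≤ d) :
    rectInt (fun z => f z - g z) a b c d = rectInt f a b c d - rectInt g a b c d := by
  have ha : a ∈ Icc a b := left_mem_Icc.2 hab
  have hb : b ∈ Icc a b := right_mem_Icc.2 hab
  have hc : c ∈ Icc c d := left_mem_Icc.2 hcd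
  have hd : d ∈ Icc c d := right_mem_Icc.2 hcd
  have hx : uIcc a b ⊆ Icc a b := (uIcc_of_le hab).le
  have hy : uIcc c d ⊆ Icc c d := (uIcc_of_le hcd).le
  simp only [rectInt]
  rw [intervalIntegral.integral_sub (intervalIntegrable_horizontal hf hc hx)
      (intervalIntegrable_horizontal hg hc hx),
    intervalIntegral.integral_sub (intervalIntegrable_horizontal hf hd hx)
      (intervalIntegrable_horizontal hg hd hx),
    intervalIntegral.integral_sub (intervalIntegrable_vertical hf ha hy)
      (intervalIntegrable_vertical hg ha hy),
    intervalIntegral.integral_sub (intervalIntegrable_vertical hf hb hy)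
      (intervalIntegrable_vertical hg hb hy)]
  simp only [smul_eq_mul]
  ring

theorem rectInt_eq_zero (hf : ContinuousOn f (Icc a b ×ℂ Icc c d)) (hab : a ≤ b) (hcd : c ≤ d)
    (hd : ∀ z ∈ Ioo a b ×ℂ Ioo c d, DifferentiableAt ℂ f z) : rectInt f a b c d = 0 := by
  have hD : DifferentiableOn ℂ f (Ioo a b ×ℂ Ioo c d) := fun z hz =>
    (hd z hz).differentiableWithinAt
  have h := integral_boundary_rect_eq_zero_of_continuousOn_of_differentiableOn f
    (a + c * I) (b + d * I) (by simpa [uIcc_of_le, hab, hcd] using hf)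
    (by simpa [hab, hcd] using hD)
  simpa [rectInt] using h

/-! ### Portions of the exceptional set and the `O(s ^ 2)` bound. -/

/-- The hypotheses on a portion `K` of the exceptional set inside the rectangle
`[A, B] × [C, D]`: the continuous function `f` is holomorphic off `K`, and its increments along
horizontal and vertical lines through the points of `K` are at most `M` times the length. -/
structure Portion (f : ℂ → ℂ) (K : Set ℂ) (A B C D M : ℝ) : Prop where
  continuousOn : ContinuousOn f (Icc A B ×ℂ Icc C D)
  isCompact : IsCompact K
  subset : K ⊆ Icc A B ×ℂ Icc C D
  differentiableAt : ∀ z ∈ Icc A B ×ℂ Icc C D, z ∉ K → DifferentiableAt ℂ f z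
  nonneg : 0 ≤ M
  horizontal : ∀ e ∈ K, ∀ x ∈ Icc A B, ‖f (x + e.im * I) - f e‖ ≤ M * |x - e.re|
  vertical : ∀ e ∈ K, ∀ y ∈ Icc C D, ‖f (e.re + y * I) - f e‖ ≤ M * |y - e.im|

variable {K : Set ℂ} {A B C D M : ℝ}

theorem Portion.continuousOn_rect (h : Portion f K A B C D M) (ha : A ≤ a) (hb : b ≤ B)
    (hc : C ≤ c) (hd : d ≤ D) : ContinuousOn f (Icc a b ×ℂ Icc c d) :=
  h.continuousOn.mono fun _ hz => ⟨Icc_subset_Icc ha hb hz.1, Icc_subset_Icc hc hd hz.2⟩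

theorem Portion.rectInt_eq_zero (h : Portion f K A B C D M) (ha : A ≤ a) (hb : b ≤ B)
    (hc : C ≤ c) (hd : d ≤ D) (hab : a ≤ b) (hcd : c ≤ d)
    (hK : ∀ z ∈ Ioo a b ×ℂ Ioo c d, z ∉ K) : rectInt f a b c d = 0 :=
  LoomanMenchoff.rectInt_eq_zero (h.continuousOn_rect ha hb hc hd) hab hcd fun z hz =>
    h.differentiableAt z ⟨Icc_subset_Icc ha hb (Ioo_subset_Icc_self hz.1),
      Icc_subset_Icc hc hd (Ioo_subset_Icc_self hz.2)⟩ (hK z hz)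

/-- A rectangle that meets `K` can be replaced by the smallest rectangle with the same points
of `K`; each of the sides of the latter contains a point of `K`. -/
theorem Portion.exists_hull (h : Portion f K A B C D M) (ha : A ≤ a) (hb : b ≤ B) (hc : C ≤ c)
    (hd : d ≤ D) {z : ℂ} (hzK : z ∈ K) (hz : z ∈ Icc a b ×ℂ Icc c d) :
    ∃ a' b' c' d' : ℝ, a ≤ a' ∧ a' ≤ b' ∧ b' ≤ b ∧ c ≤ c' ∧ c' ≤ d' ∧ d' ≤ d ∧
      rectInt f a b c d = rectInt f a' b' c' d' ∧
      (∃ p ∈ K, p.im = c' ∧ p.re ∈ Icc a' b') ∧ (∃ p ∈ K, p.im = d' ∧ p.re ∈ Icc a' b') ∧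
      (∃ p ∈ K, p.re = a' ∧ p.im ∈ Icc c' d') ∧ (∃ p ∈ K, p.re = b' ∧ p.im ∈ Icc c' d') := by
  have hS : IsCompact (K ∩ Icc a b ×ℂ Icc c d) :=
    h.isCompact.inter_right (isClosed_Icc.reProdIm isClosed_Icc)
  have hne : (K ∩ Icc a b ×ℂ Icc c d).Nonempty := ⟨z, hzK, hz⟩
  obtain ⟨pa, ⟨hpaK, hpa⟩, hpam⟩ := hS.exists_isMinOn hne continuous_re.continuousOn
  obtain ⟨pb, ⟨hpbK, hpb⟩, hpbm⟩ := hS.exists_isMaxOn hne continuous_re.continuousOn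
  obtain ⟨pc, ⟨hpcK, hpc⟩, hpcm⟩ := hS.exists_isMinOn hne continuous_im.continuousOn
  obtain ⟨pd, ⟨hpdK, hpd⟩, hpdm⟩ := hS.exists_isMaxOn hne continuous_im.continuousOn
  have hmin (p : ℂ) (hp : p ∈ K) (hp' : p ∈ Icc a b ×ℂ Icc c d) :
      p.re ∈ Icc pa.re pb.re ∧ p.im ∈ Icc pc.im pd.im :=
    ⟨⟨hpam ⟨hp, hp'⟩, hpbm ⟨hp, hp'⟩⟩, ⟨hpcm ⟨hp, hp'⟩, hpdm ⟨hp, hp'⟩⟩⟩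
  obtain ⟨⟨haz, hzb⟩, ⟨hcz, hzd⟩⟩ := hmin z hzK hz
  have hab' := haz.trans hzb
  have hcd' := hcz.trans hzd
  have hpa1 : a ≤ pa.re := hpa.1.1
  have hpb2 : pb.re ≤ b := hpb.1.2
  have hpc1 : c ≤ pc.im := hpc.2.1
  have hpd2 : pd.im ≤ d := hpd.2.2
  refine ⟨pa.re, pb.re, pc.im, pd.im, hpa1, hab', hpb2, hpc1, hcd', hpd2, ?_,
    ⟨pc, hpcK, rfl, (hmin pc hpcK hpc).1⟩, ⟨pd, hpdK, rfl, (hmin pd hpdK hpd).1⟩,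
    ⟨pa, hpaK, rfl, (hmin pa hpaK hpa).2⟩, ⟨pb, hpbK, rfl, (hmin pb hpbK hpb).2⟩⟩
  have hcd : c ≤ d := by linarith
  -- Cut off a strip on each of the four sides. The open strips miss `K` by extremality, so their
  -- integrals vanish even if `K` meets their edges.
  rw [rectInt_add_re (h.continuousOn_rect ha hb hc hd) hcd (m := pa.re) ⟨hpa1, by linarith⟩,
    rectInt_add_re (h.continuousOn_rect (ha.trans hpa1) hb hc hd) hcd (m := pb.re) ⟨hab', hpb2⟩,
    rectInt_add_im (h.continuousOn_rect (ha.trans hpa1) (hpb2.trans hb) hc hd) hab' (m := pc.im)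
      ⟨hpc1, by linarith⟩,
    rectInt_add_im (h.continuousOn_rect (ha.trans hpa1) (hpb2.trans hb) (hc.trans hpc1) hd) hab'
      (m := pd.im) ⟨hcd', hpd2⟩,
    h.rectInt_eq_zero ha (by linarith) hc hd hpa1 hcd, h.rectInt_eq_zero (by linarith) hb hc hd
      hpb2 hcd, h.rectInt_eq_zero (by linarith) (by linarith) hc (by linarith) hab' hpc1,
    h.rectInt_eq_zero (by linarith) (by linarith) (by linarith) hd hab' hpd2]
  · ring
  · rintro p ⟨⟨h1, h2⟩, ⟨h3, h4⟩⟩ hp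
    have := (hmin p hp ⟨⟨by linarith, by linarith⟩, ⟨by linarith, by linarith⟩⟩).2.2
    linarith
  · rintro p ⟨⟨h1, h2⟩, ⟨h3, h4⟩⟩ hp
    have := (hmin p hp ⟨⟨by linarith, by linarith⟩, ⟨by linarith, by linarith⟩⟩).2.1
    linarith
  · rintro p ⟨⟨h1, h2⟩, ⟨h3, h4⟩⟩ hp
    have := (hmin p hp ⟨⟨by linarith, by linarith⟩, ⟨by linarith, by linarith⟩⟩).1.2
    linarith
  · rintro p ⟨⟨h1, h2⟩, ⟨h3, h4⟩⟩ hp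
    have := (hmin p hp ⟨⟨by linarith, by linarith⟩, ⟨by linarith, by linarith⟩⟩).1.1
    linarith

/-- The path from `p` to `q` through the corner `(p.re, q.im)` has one leg through each point. The
corner need not lie in `K`, only in the rectangle. -/
theorem Portion.norm_sub_le_of_mem (h : Portion f K A B C D M) {p q : ℂ} (hp : p ∈ K) (hq : q ∈ K) :
    ‖f p - f q‖ ≤ M * |p.re - q.re| + M * |p.im - q.im| := by
  have h1 := h.vertical p hp q.im (h.subset hq).2
  have h2 := h.horizontal q hq p.re (h.subset hp).1
  rw [abs_sub_comm] at h1
  calc ‖f p - f q‖ = ‖(f (p.re + q.im * I) - f q) - (f (p.re + q.im * I) - f p)‖ := by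
        congr 1; ring
    _ ≤ _ := (norm_sub_le _ _).trans (add_le_add h2 h1)

/-- This makes Rademacher's theorem available on `K`. -/
theorem Portion.lipschitzOnWith (h : Portion f K A B C D M) :
    LipschitzOnWith (2 * M).toNNReal f K := by
  refine LipschitzOnWith.of_dist_le_mul fun p hp q hq => ?_
  rw [Real.coe_toNNReal _ (by linarith [h.nonneg]), dist_eq, dist_eq]
  have h1 := h.norm_sub_le_of_mem hp hq
  have h2 := abs_re_le_norm (p - q)
  have h3 := abs_im_le_norm (p - q)
  rw [sub_re] at h2
  rw [sub_im] at h3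
  nlinarith [h.nonneg]

theorem Portion.sub_const (h : Portion f K A B C D M) (k : ℂ) :
    Portion (fun z => f z - k) K A B C D M where
  continuousOn := h.continuousOn.sub continuousOn_const
  isCompact := h.isCompact
  subset := h.subset
  differentiableAt z hz hzK := (h.differentiableAt z hz hzK).sub_const k
  nonneg := h.nonneg
  horizontal e he x hx := by simpa using h.horizontal e he x hx
  vertical e he y hy := by simpa using h.vertical e he y hy

theorem rectInt_sub_const (hf : ContinuousOn f (Icc a b ×ℂ Icc c d)) (hab : a ≤ b) (hcd : c ≤ d)
    (k : ℂ) : rectInt (fun z => f z - k) a b c d = rectInt f a b c d := by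
  rw [rectInt_sub hf continuousOn_const hab hcd,
    rectInt_eq_zero (f := fun _ => k) continuousOn_const hab hcd fun z _ =>
      differentiableAt_const k, sub_zero]

/-- Boundary integrals over rectangles with sides at most `s` are at most `12 M s ^ 2`. -/
theorem Portion.norm_rectInt_le (h : Portion f K A B C D M) (ha : A ≤ a) (hb : b ≤ B) (hc : C ≤ c)
    (hd : d ≤ D) (hab : a ≤ b) (hcd : c ≤ d) {s : ℝ} (hs₁ : b - a ≤ s) (hs₂ : d - c ≤ s) :
    ‖rectInt f a b c d‖ ≤ 12 * M * s ^ 2 := by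
  have hM := h.nonneg
  have hs : 0 ≤ s := by linarith
  by_cases hK : ∃ z ∈ K, z ∈ Icc a b ×ℂ Icc c d
  · obtain ⟨z, hzK, hz⟩ := hK
    -- After subtraction of `f z` the function is at most `2 * M * s` at the points of `K` in the
    -- rectangle, hence at most `3 * M * s` on a side through such a point; four sides of length at
    -- most `s` give the 12.
    rw [← rectInt_sub_const (h.continuousOn_rect ha hb hc hd) hab hcd (f z)]
    have h' := h.sub_const (f z)
    obtain ⟨a', b', c', d', haa, hab', hbb, hcc, hcd', hdd, heq, ⟨p, hpK, hp, hp'⟩,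
      ⟨q, hqK, hq, hq'⟩, ⟨r, hrK, hr, hr'⟩, ⟨t, htK, ht, ht'⟩⟩ :=
      h'.exists_hull ha hb hc hd hzK hz
    rw [heq]
    have hK (p : ℂ) (hpK : p ∈ K) (h1 : p.re ∈ Icc a' b') (h2 : p.im ∈ Icc c' d') :
        ‖f p - f z‖ ≤ 2 * M * s := by
      have h3 : |p.re - z.re| ≤ s := by
        rw [abs_le]; constructor <;> linarith [h1.1, h1.2, hz.1.1, hz.1.2]
      have h4 : |p.im - z.im| ≤ s := by
        rw [abs_le]; constructor <;> linarith [h2.1, h2.2, hz.2.1, hz.2.2]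
      have := h.norm_sub_le_of_mem hpK hzK
      nlinarith
    have hor (p : ℂ) (hpK : p ∈ K) (h1 : p.re ∈ Icc a' b') (h2 : p.im ∈ Icc c' d') :
        ‖∫ x : ℝ in a'..b', (fun w => f w - f z) (x + p.im * I)‖ ≤ 3 * M * s * s := by
      refine (intervalIntegral.norm_integral_le_of_norm_le_const (C := 3 * M * s)
        fun x hx => ?_).trans ?_
      · rw [uIoc_of_le hab'] at hx
        have h3 := h.horizontal p hpK x ⟨by linarith [hx.1], by linarith [hx.2]⟩
        have h4 : |x - p.re| ≤ s := by
          rw [abs_le]; constructor <;> linarith [h1.1, h1.2, hx.1, hx.2]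
        have h5 := norm_sub_le_norm_sub_add_norm_sub (f (x + p.im * I)) (f p) (f z)
        have h6 := hK p hpK h1 h2
        dsimp only
        nlinarith
      · rw [abs_of_nonneg (by linarith)]
        exact mul_le_mul_of_nonneg_left (by linarith) (by positivity)
    have ver (p : ℂ) (hpK : p ∈ K) (h1 : p.re ∈ Icc a' b') (h2 : p.im ∈ Icc c' d') :
        ‖∫ y : ℝ in c'..d', (fun w => f w - f z) (p.re + y * I)‖ ≤ 3 * M * s * s := by
      refine (intervalIntegral.norm_integral_le_of_norm_le_const (C := 3 * M * s)
        fun x hx => ?_).trans ?_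
      · rw [uIoc_of_le hcd'] at hx
        have h3 := h.vertical p hpK x ⟨by linarith [hx.1], by linarith [hx.2]⟩
        have h4 : |x - p.im| ≤ s := by
          rw [abs_le]; constructor <;> linarith [h2.1, h2.2, hx.1, hx.2]
        have h5 := norm_sub_le_norm_sub_add_norm_sub (f (p.re + x * I)) (f p) (f z)
        have h6 := hK p hpK h1 h2
        dsimp only
        nlinarith
      · rw [abs_of_nonneg (by linarith)]
        exact mul_le_mul_of_nonneg_left (by linarith) (by positivity)
    subst hp hq hr ht
    refine (LoomanMenchoff.norm_rectInt_le (hor p hpK hp' (left_mem_Icc.2 hcd'))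
      (hor q hqK hq' (right_mem_Icc.2 hcd')) (ver t htK (right_mem_Icc.2 hab') ht')
      (ver r hrK (left_mem_Icc.2 hab') hr')).trans (le_of_eq ?_)
    ring
  · push Not at hK
    rw [h.rectInt_eq_zero ha hb hc hd hab hcd fun z hz hzK => hK z hzK
      ⟨Ioo_subset_Icc_self hz.1, Ioo_subset_Icc_self hz.2⟩, norm_zero]
    positivity

/-! ### Density points and the `o(s ^ 2)` bound. -/

theorem volume_reProdIm (s t : Set ℝ) : volume (s ×ℂ t) = volume s * volume t := by
  rw [← Measure.prod_prod, ← Measure.volume_eq_prod,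
    ← volume_preserving_equiv_real_prod.measure_preimage_equiv]
  rfl

/-- An interval integral is small if the integrand is small off a set of small measure. -/
theorem norm_integral_le_of_norm_le_off {φ : ℝ → ℂ} {a b : ℝ} (hab : a ≤ b) {B : Set ℝ}
    {L₁ L₂ β : ℝ} (hL₁ : 0 ≤ L₁) (hL₂ : 0 ≤ L₂) (hβ : 0 ≤ β)
    (h₁ : ∀ x ∈ Icc a b, x ∉ B → ‖φ x‖ ≤ L₁) (h₂ : ∀ x ∈ Icc a b, ‖φ x‖ ≤ L₂)
    (hB : volume B ≤ ENNReal.ofReal β) :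
    ‖∫ x in a..b, φ x‖ ≤ L₁ * (b - a) + L₂ * β := by
  -- `B` is not assumed measurable, so its measurable hull takes its place.
  set T := toMeasurable volume B with hT
  have hTm : MeasurableSet T := measurableSet_toMeasurable _ _
  have hTv : volume T ≤ ENNReal.ofReal β := by rwa [hT, measure_toMeasurable]
  have hTint : Integrable (T.indicator fun _ => L₂) volume :=
    (integrable_indicator_iff hTm).2
      (integrableOn_const (hTv.trans_lt ENNReal.ofReal_lt_top).ne)
  have hle : ∫ x in a..b, T.indicator (fun _ => L₂) x ≤ L₂ * β := by
    rw [intervalIntegral.integral_of_le hab]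
    refine (setIntegral_le_integral hTint (Eventually.of_forall fun x =>
      indicator_nonneg (fun _ _ => hL₂) x)).trans ?_
    rw [integral_indicator hTm, setIntegral_const, smul_eq_mul, mul_comm]
    exact mul_le_mul_of_nonneg_left (ENNReal.toReal_le_of_le_ofReal hβ hTv) hL₂
  calc ‖∫ x in a..b, φ x‖ ≤ ∫ x in a..b, (L₁ + T.indicator (fun _ => L₂) x) := by
        refine intervalIntegral.norm_integral_le_of_norm_le hab
          (Eventually.of_forall fun x hx => ?_)
          (intervalIntegrable_const.add hTint.intervalIntegrable)
        have hx' : x ∈ Icc a b := Ioc_subset_Icc_self hx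
        by_cases hxT : x ∈ T
        · rw [indicator_of_mem hxT]
          linarith [h₂ x hx']
        · rw [indicator_of_notMem hxT, add_zero]
          exact h₁ x hx' fun hxB => hxT (subset_toMeasurable _ _ hxB)
    _ ≤ L₁ * (b - a) + L₂ * β := by
        rw [intervalIntegral.integral_add intervalIntegrable_const hTint.intervalIntegrable,
          intervalIntegral.integral_const, smul_eq_mul, mul_comm]
        linarith

/-- `z` is a density point of `K`, for closed balls. -/
def IsDensityPoint (K : Set ℂ) (z : ℂ) : Prop :=
  ∀ η : ℝ, 0 < η → ∀ᶠ r in 𝓝[>] (0 : ℝ),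
    volume (Metric.closedBall z r \ K) ≤ ENNReal.ofReal (η * r ^ 2)

theorem ae_isDensityPoint {K : Set ℂ} (hK : MeasurableSet K) :
    ∀ᵐ z : ℂ, z ∈ K → IsDensityPoint K z := by
  filter_upwards [Besicovitch.ae_tendsto_measure_inter_div_of_measurableSet volume hK.compl]
    with z hz hzK η hη
  rw [indicator_of_notMem (by simpa using hzK)] at hz
  -- The factor `π` is the area of the unit disc: the density theorem compares with `π * r ^ 2`.
  have hη' : 0 < ENNReal.ofReal (η / Real.pi) := by
    simpa using div_pos hη Real.pi_pos
  filter_upwards [hz.eventually (gt_mem_nhds hη'), self_mem_nhdsWithin] with r hr hr0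
  have hr0 : (0 : ℝ) < r := hr0
  rw [Complex.volume_closedBall] at hr
  have hpos : ENNReal.ofReal r ^ 2 * NNReal.pi ≠ 0 := by
    simp [hr0, NNReal.pi_pos.ne']
  have htop : ENNReal.ofReal r ^ 2 * NNReal.pi ≠ ⊤ := by
    simp [ENNReal.mul_eq_top]
  rw [sdiff_eq, inter_comm]
  refine ((ENNReal.div_le_iff hpos htop).1 hr.le).trans (le_of_eq ?_)
  rw [← ENNReal.ofReal_pow hr0.le, ← ENNReal.ofReal_coe_nnreal, NNReal.coe_real_pi,
    ← ENNReal.ofReal_mul (by positivity), ← ENNReal.ofReal_mul (by positivity)]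
  congr 1
  field_simp

theorem reProdIm_subset_closedBall {z : ℂ} {s : ℝ} {S T : Set ℝ}
    (hS : ∀ x ∈ S, |x - z.re| ≤ s) (hT : ∀ y ∈ T, |y - z.im| ≤ 2 * s) :
    S ×ℂ T ⊆ Metric.closedBall z (3 * s) := by
  intro w hw
  rw [mem_closedBall_iff_norm]
  have h1 := hS _ hw.1
  have h2 := hT _ hw.2
  have h3 := norm_le_abs_re_add_abs_im (w - z)
  rw [sub_re, sub_im] at h3
  linarith

theorem reProdIm_subset_closedBall' {z : ℂ} {s : ℝ} {S T : Set ℝ}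
    (hS : ∀ x ∈ S, |x - z.re| ≤ 2 * s) (hT : ∀ y ∈ T, |y - z.im| ≤ s) :
    S ×ℂ T ⊆ Metric.closedBall z (3 * s) := by
  intro w hw
  rw [mem_closedBall_iff_norm]
  have h1 := hS _ hw.1
  have h2 := hT _ hw.2
  have h3 := norm_le_abs_re_add_abs_im (w - z)
  rw [sub_re, sub_im] at h3
  linarith

/-- If a set `S ×ℂ T` misses `K` and `T` has length `δ s`, then `S` has measure at most `δ s`. -/
theorem volume_le_of_mul_le {S T : Set ℝ} {δ s : ℝ} (hδ : 0 < δ) (hs : 0 < s)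
    (hT : volume T = ENNReal.ofReal (δ * s))
    (h : volume S * volume T ≤ ENNReal.ofReal (δ ^ 2 / 9 * (3 * s) ^ 2)) :
    volume S ≤ ENNReal.ofReal (δ * s) := by
  have hpos : ENNReal.ofReal (δ * s) ≠ 0 := by
    simpa using mul_pos hδ hs
  rw [hT] at h
  refine (ENNReal.mul_le_mul_iff_left hpos ENNReal.ofReal_ne_top).1 (h.trans (le_of_eq ?_))
  rw [← ENNReal.ofReal_mul (by positivity)]
  congr 1
  ring

/-- The derivative within `K` sees only points of `K`, the partial derivatives only points of the
axes through `z`. At a density point, thin rectangles along the axes contain points of `K`, and the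
increment bound transfers the smallness of `f` from the axis to them. -/
theorem Portion.fderivWithin_eq_zero (h : Portion f K A B C D M) {z : ℂ} (hzK : z ∈ K)
    (hdens : IsDensityPoint K z) {L : ℂ →L[ℝ] ℂ} (hL : HasFDerivWithinAt f L K z)
    (hfz : f z = 0) (hre : HasDerivAt (fun t : ℝ => f (z + t)) 0 0)
    (him : HasDerivAt (fun t : ℝ => f (z + t * I)) 0 0) : L = 0 := by
  have key : ∀ δ : ℝ, 0 < δ → δ < 1 → ‖L 1‖ ≤ 2 * (‖L‖ + M + 3) * δ ∧
      ‖L I‖ ≤ 2 * (‖L‖ + M + 3) * δ := by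
    intro δ hδ hδ1
    have hM := h.nonneg
    have e1 : ∀ᶠ s in 𝓝[>] (0 : ℝ), volume (Metric.closedBall z (3 * s) \ K) ≤
        ENNReal.ofReal (δ / 27 * (3 * s) ^ 2) := by
      have : Tendsto (fun s : ℝ => 3 * s) (𝓝[>] 0) (𝓝[>] 0) := by
        refine tendsto_nhdsWithin_iff.2 ⟨?_, ?_⟩
        · exact (Continuous.tendsto' (by fun_prop) _ _ (by simp)).mono_left nhdsWithin_le_nhds
        · filter_upwards [self_mem_nhdsWithin] with s hs
          simpa using hs
      exact this.eventually (hdens (δ / 27) (by positivity))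
    have e2 := Asymptotics.isLittleO_iff.1 hL.isLittleO hδ
    have e3 := Asymptotics.isLittleO_iff.1 hre.isLittleO hδ
    have e4 := Asymptotics.isLittleO_iff.1 him.isLittleO hδ
    obtain ⟨r₂, hr₂, e2⟩ := Metric.mem_nhdsWithin_iff.1 e2
    obtain ⟨r₃, hr₃, e3⟩ := Metric.eventually_nhds_iff.1 e3
    obtain ⟨r₄, hr₄, e4⟩ := Metric.eventually_nhds_iff.1 e4
    obtain ⟨s, e1, hs0, hs3⟩ := (e1.and (Ioo_mem_nhdsGT
      (show (0 : ℝ) < min (r₂ / 3) (min r₃ r₄) by positivity))).exists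
    obtain ⟨hs2, hs3, hs4⟩ : s < r₂ / 3 ∧ s < r₃ ∧ s < r₄ := by simpa using hs3
    have hδs : δ * s < s := by nlinarith
    -- The test rectangles have area `δ * s ^ 2 / 2`, while the complement of `K` occupies at most
    -- `δ / 27 * (3 * s) ^ 2 = δ * s ^ 2 / 3` of the ball.
    have hmeas {S T : Set ℝ} (hsub : S ×ℂ T ⊆ Metric.closedBall z (3 * s))
        (hST : volume S * volume T = ENNReal.ofReal (δ * s ^ 2 / 2)) :
        ∃ e ∈ K, e ∈ S ×ℂ T := by
      by_contra! hcon
      have h1 : volume (S ×ℂ T) ≤ ENNReal.ofReal (δ / 27 * (3 * s) ^ 2) :=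
        (measure_mono (t := Metric.closedBall z (3 * s) \ K) fun w hw => ⟨hsub hw, fun hwK => hcon w hwK hw⟩).trans e1
      rw [volume_reProdIm, hST, ENNReal.ofReal_le_ofReal_iff (by positivity)] at h1
      nlinarith [mul_pos hδ (pow_pos hs0 2)]
    have hnear (e : ℂ) (heK : e ∈ K) (h1 : |e.re - z.re| ≤ s) (h2 : |e.im - z.im| ≤ s) :
        ‖L (e - z)‖ ≤ ‖f e‖ + δ * (2 * s) := by
      have h3 := norm_le_abs_re_add_abs_im (e - z)
      rw [sub_re, sub_im] at h3
      have h4 := e2 ⟨by rw [mem_ball_iff_norm]; linarith, heK⟩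
      simp only [mem_ofPred_eq, hfz, sub_zero] at h4
      have h5 := norm_sub_norm_le (L (e - z)) (f e)
      rw [norm_sub_rev] at h5
      nlinarith
    have hv (u v : ℝ) : volume (Icc u v) = ENNReal.ofReal (v - u) := Real.volume_Icc
    constructor
    -- The point `e` lies within `δ * s` of the horizontal axis and at horizontal distance at least
    -- `s / 2` from `z`, so `L (e - z)` controls `L 1` up to `δ * s * ‖L‖`.
    · obtain ⟨e, heK, ⟨h1, h2⟩, h3, h4⟩ := hmeas
        (S := Icc (z.re + s / 2) (z.re + s)) (T := Icc z.im (z.im + δ * s))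
        (reProdIm_subset_closedBall
          (fun x hx => by rw [abs_le]; constructor <;> linarith [hx.1, hx.2])
          (fun x hx => by rw [abs_le]; constructor <;> linarith [hx.1, hx.2]))
        (by rw [hv, hv, ← ENNReal.ofReal_mul (by linarith)]; congr 1; ring)
      have h5 := hnear e heK (by rw [abs_le]; constructor <;> linarith)
        (by rw [abs_le]; constructor <;> linarith)
      have h6 := h.vertical e heK z.im (h.subset hzK).2
      have h7 := e3 (y := e.re - z.re) (by
        rw [dist_zero_right, Real.norm_eq_abs, abs_lt]; constructor <;> linarith)
      have h8 : z + ((e.re - z.re : ℝ) : ℂ) = e.re + z.im * I := by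
        apply Complex.ext <;> simp
      rw [h8] at h7
      simp only [ofReal_zero, add_zero, hfz, sub_zero, smul_zero, Real.norm_eq_abs] at h7
      rw [abs_of_nonneg (by linarith)] at h7
      rw [abs_sub_comm, abs_of_nonneg (by linarith)] at h6
      have h9 : L (e - z) = ((e.re - z.re : ℝ) : ℂ) * L 1 + ((e.im - z.im : ℝ) : ℂ) * L I := by
        have : e - z = (e.re - z.re) • (1 : ℂ) + (e.im - z.im) • I := by
          apply Complex.ext <;> simp
        rw [this, map_add, map_smul, map_smul, real_smul, real_smul]
      have h10 : ‖L I‖ ≤ ‖L‖ := by simpa using L.le_opNorm I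
      have h11 := norm_sub_le (L (e - z)) (((e.im - z.im : ℝ) : ℂ) * L I)
      rw [h9, add_sub_cancel_right, ← h9, norm_mul, norm_mul, norm_real, norm_real,
        Real.norm_eq_abs, Real.norm_eq_abs, abs_of_nonneg (by linarith),
        abs_of_nonneg (by linarith)] at h11
      have h12 := norm_sub_norm_le (f e) (f (e.re + z.im * I))
      rw [norm_sub_rev] at h12
      have h13 : (e.im - z.im) * ‖L I‖ ≤ δ * s * ‖L‖ :=
        mul_le_mul (by linarith) h10 (norm_nonneg _) (by positivity)
      have h14 : s / 2 * ‖L 1‖ ≤ (e.re - z.re) * ‖L 1‖ :=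
        mul_le_mul_of_nonneg_right (by linarith) (norm_nonneg _)
      have h15 : M * (e.im - z.im) ≤ M * (δ * s) := mul_le_mul_of_nonneg_left (by linarith) hM
      have h16 : δ * (e.re - z.re) ≤ δ * s := mul_le_mul_of_nonneg_left (by linarith) hδ.le
      have h17 : s / 2 * ‖L 1‖ ≤ s / 2 * (2 * (‖L‖ + M + 3) * δ) := by nlinarith
      exact le_of_mul_le_mul_left h17 (by positivity)
    · obtain ⟨e, heK, ⟨h1, h2⟩, h3, h4⟩ := hmeas
        (S := Icc z.re (z.re + δ * s)) (T := Icc (z.im + s / 2) (z.im + s))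
        (reProdIm_subset_closedBall
          (fun x hx => by rw [abs_le]; constructor <;> linarith [hx.1, hx.2])
          (fun x hx => by rw [abs_le]; constructor <;> linarith [hx.1, hx.2]))
        (by rw [hv, hv, ← ENNReal.ofReal_mul (by linarith [mul_pos hδ hs0])]; congr 1; ring)
      have h5 := hnear e heK (by rw [abs_le]; constructor <;> linarith)
        (by rw [abs_le]; constructor <;> linarith)
      have h6 := h.horizontal e heK z.re (h.subset hzK).1
      have h7 := e4 (y := e.im - z.im) (by
        rw [dist_zero_right, Real.norm_eq_abs, abs_lt]; constructor <;> linarith)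
      have h8 : z + ((e.im - z.im : ℝ) : ℂ) * I = z.re + e.im * I := by
        apply Complex.ext <;> simp
      rw [h8] at h7
      simp only [ofReal_zero, zero_mul, add_zero, hfz, sub_zero, smul_zero,
        Real.norm_eq_abs] at h7
      rw [abs_of_nonneg (by linarith)] at h7
      rw [abs_sub_comm, abs_of_nonneg (by linarith)] at h6
      have h9 : L (e - z) = ((e.re - z.re : ℝ) : ℂ) * L 1 + ((e.im - z.im : ℝ) : ℂ) * L I := by
        have : e - z = (e.re - z.re) • (1 : ℂ) + (e.im - z.im) • I := by
          apply Complex.ext <;> simp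
        rw [this, map_add, map_smul, map_smul, real_smul, real_smul]
      have h10 : ‖L 1‖ ≤ ‖L‖ := by simpa using L.le_opNorm 1
      have h11 := norm_sub_le (L (e - z)) (((e.re - z.re : ℝ) : ℂ) * L 1)
      rw [h9, add_sub_cancel_left, ← h9, norm_mul, norm_mul, norm_real, norm_real,
        Real.norm_eq_abs, Real.norm_eq_abs, abs_of_nonneg (by linarith),
        abs_of_nonneg (by linarith)] at h11
      have h12 := norm_sub_norm_le (f e) (f (z.re + e.im * I))
      rw [norm_sub_rev] at h12
      have h13 : (e.re - z.re) * ‖L 1‖ ≤ δ * s * ‖L‖ :=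
        mul_le_mul (by linarith) h10 (norm_nonneg _) (by positivity)
      have h14 : s / 2 * ‖L I‖ ≤ (e.im - z.im) * ‖L I‖ :=
        mul_le_mul_of_nonneg_right (by linarith) (norm_nonneg _)
      have h15 : M * (e.re - z.re) ≤ M * (δ * s) := mul_le_mul_of_nonneg_left (by linarith) hM
      have h16 : δ * (e.im - z.im) ≤ δ * s := mul_le_mul_of_nonneg_left (by linarith) hδ.le
      have h17 : s / 2 * ‖L I‖ ≤ s / 2 * (2 * (‖L‖ + M + 3) * δ) := by nlinarith
      exact le_of_mul_le_mul_left h17 (by positivity)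
  have hzero {u : ℝ} {k : ℝ} (hu : ∀ δ : ℝ, 0 < δ → δ < 1 → u ≤ k * δ) : u ≤ 0 := by
    have ht : Tendsto (fun δ : ℝ => k * δ) (𝓝[>] 0) (𝓝 0) :=
      (Continuous.tendsto' (by fun_prop) _ _ (by simp)).mono_left nhdsWithin_le_nhds
    refine ge_of_tendsto ht ?_
    filter_upwards [Ioo_mem_nhdsGT (show (0 : ℝ) < 1 by norm_num)] with δ hδ
    exact hu δ hδ.1 hδ.2
  have h1 : L 1 = 0 := norm_le_zero_iff.1 (hzero fun δ hδ hδ1 => (key δ hδ hδ1).1)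
  have hI : L I = 0 := norm_le_zero_iff.1 (hzero fun δ hδ hδ1 => (key δ hδ hδ1).2)
  refine ContinuousLinearMap.ext fun w => ?_
  have hw : w = w.re • (1 : ℂ) + w.im • I := by apply Complex.ext <;> simp
  rw [hw, map_add, map_smul, map_smul, h1, hI]
  simp

/-- The integral over a horizontal side through a point of `K` is small near a density point. -/
theorem Portion.norm_integral_horizontal_le (h : Portion f K A B C D M) {z p : ℂ} {a b δ s : ℝ}
    (hδ : 0 < δ) (hδ1 : δ < 1) (hs : 0 < s)
    (hvol : volume (Metric.closedBall z (3 * s) \ K) ≤ ENNReal.ofReal (δ ^ 2 / 9 * (3 * s) ^ 2))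
    (hsmall : ∀ e ∈ K, |e.re - z.re| + |e.im - z.im| ≤ 3 * s → ‖f e‖ ≤ δ * (3 * s))
    (ha : A ≤ a) (hb : b ≤ B) (hab : a ≤ b) (hbs : b - a ≤ s) (hz : z.re ∈ Icc (b - s) (a + s))
    (hpK : p ∈ K) (hp : p.re ∈ Icc a b) (hpz : |p.im - z.im| ≤ s) :
    ‖∫ x : ℝ in a..b, f (x + p.im * I)‖ ≤ (6 + 2 * M) * δ * s ^ 2 := by
  have hM := h.nonneg
  have hδs : δ * s < s := by nlinarith
  have hδs0 : 0 < δ * s := by positivity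
  have habs : ∀ x ∈ Icc a b, |x - z.re| ≤ s := fun x hx => by
    rw [abs_le]; constructor <;> linarith [hx.1, hx.2, hz.1, hz.2]
  have habs' : ∀ y ∈ Icc p.im (p.im + δ * s), |y - z.im| ≤ 2 * s := fun y hy => by
    rw [abs_le] at hpz ⊢; constructor <;> linarith [hy.1, hy.2]
  -- The abscissas with no point of `K` within `δ * s` above the side. The product of `S` with an
  -- interval of length `δ * s` misses `K` and so has area at most `δ ^ 2 * s ^ 2`.
  set S : Set ℝ := {x ∈ Icc a b | ∀ e ∈ K, e.re = x → e.im ∉ Icc p.im (p.im + δ * s)}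
  have hS : volume S ≤ ENNReal.ofReal (δ * s) := by
    refine volume_le_of_mul_le (T := Icc p.im (p.im + δ * s)) hδ hs
      (by rw [Real.volume_Icc]; congr 1; ring) ?_
    rw [← volume_reProdIm]
    exact (measure_mono (t := Metric.closedBall z (3 * s) \ K) fun w hw => ⟨reProdIm_subset_closedBall (S := S)
      (fun x hx => habs x hx.1) habs' hw, fun hwK => hw.1.2 w hwK rfl hw.2⟩).trans hvol
  -- Off `S` the value is compared with a point of `K` at vertical distance at most `δ * s`; on `S`
  -- only with `p`, at distance at most `s`.
  refine (norm_integral_le_of_norm_le_off hab (L₁ := (3 + M) * δ * s)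
    (L₂ := (3 + M) * s) (β := δ * s) (by positivity) (by positivity) (by positivity)
    (fun x hx hxS => ?_) (fun x hx => ?_) hS).trans ?_
  · obtain ⟨e, heK, rfl, he⟩ : ∃ e ∈ K, e.re = x ∧ e.im ∈ Icc p.im (p.im + δ * s) := by
      by_contra! hcon
      exact hxS ⟨hx, hcon⟩
    have h5 := hsmall e heK (by linarith [habs _ hx, habs' _ he])
    have h6 := h.vertical e heK p.im (h.subset hpK).2
    rw [abs_sub_comm, abs_of_nonneg (by linarith [he.1])] at h6
    have h7 := norm_sub_norm_le (f (e.re + p.im * I)) (f e)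
    have h8 : M * (e.im - p.im) ≤ M * (δ * s) :=
      mul_le_mul_of_nonneg_left (by linarith [he.2]) hM
    linarith
  · have h5 : |x - p.re| ≤ s := by
      rw [abs_le]; constructor <;> linarith [hx.1, hx.2, hp.1, hp.2]
    have h8 := hsmall p hpK (by linarith [habs _ hp])
    have h6 := h.horizontal p hpK x ⟨by linarith [hx.1], by linarith [hx.2]⟩
    have h7 := norm_sub_norm_le (f (x + p.im * I)) (f p)
    have h9 : M * |x - p.re| ≤ M * s := mul_le_mul_of_nonneg_left h5 hM
    linarith
  · have : (3 + M) * δ * s * (b - a) ≤ (3 + M) * δ * s * s :=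
      mul_le_mul_of_nonneg_left hbs (by positivity)
    linarith

/-- The integral over a vertical side through a point of `K` is small near a density point. -/
theorem Portion.norm_integral_vertical_le (h : Portion f K A B C D M) {z p : ℂ} {a b δ s : ℝ}
    (hδ : 0 < δ) (hδ1 : δ < 1) (hs : 0 < s)
    (hvol : volume (Metric.closedBall z (3 * s) \ K) ≤ ENNReal.ofReal (δ ^ 2 / 9 * (3 * s) ^ 2))
    (hsmall : ∀ e ∈ K, |e.re - z.re| + |e.im - z.im| ≤ 3 * s → ‖f e‖ ≤ δ * (3 * s))
    (ha : C ≤ a) (hb : b ≤ D) (hab : a ≤ b) (hbs : b - a ≤ s) (hz : z.im ∈ Icc (b - s) (a + s))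
    (hpK : p ∈ K) (hp : p.im ∈ Icc a b) (hpz : |p.re - z.re| ≤ s) :
    ‖∫ x : ℝ in a..b, f (p.re + x * I)‖ ≤ (6 + 2 * M) * δ * s ^ 2 := by
  have hM := h.nonneg
  have hδs : δ * s < s := by nlinarith
  have hδs0 : 0 < δ * s := by positivity
  have habs : ∀ x ∈ Icc a b, |x - z.im| ≤ s := fun x hx => by
    rw [abs_le]; constructor <;> linarith [hx.1, hx.2, hz.1, hz.2]
  have habs' : ∀ y ∈ Icc p.re (p.re + δ * s), |y - z.re| ≤ 2 * s := fun y hy => by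
    rw [abs_le] at hpz ⊢; constructor <;> linarith [hy.1, hy.2]
  set S : Set ℝ := {x ∈ Icc a b | ∀ e ∈ K, e.im = x → e.re ∉ Icc p.re (p.re + δ * s)}
  have hS : volume S ≤ ENNReal.ofReal (δ * s) := by
    refine volume_le_of_mul_le (T := Icc p.re (p.re + δ * s)) hδ hs
      (by rw [Real.volume_Icc]; congr 1; ring) ?_
    rw [mul_comm, ← volume_reProdIm]
    exact (measure_mono (t := Metric.closedBall z (3 * s) \ K) fun w hw => ⟨reProdIm_subset_closedBall' (T := S)
      habs' (fun x hx => habs x hx.1) hw, fun hwK => hw.2.2 w hwK rfl hw.1⟩).trans hvol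
  refine (norm_integral_le_of_norm_le_off hab (L₁ := (3 + M) * δ * s)
    (L₂ := (3 + M) * s) (β := δ * s) (by positivity) (by positivity) (by positivity)
    (fun x hx hxS => ?_) (fun x hx => ?_) hS).trans ?_
  · obtain ⟨e, heK, rfl, he⟩ : ∃ e ∈ K, e.im = x ∧ e.re ∈ Icc p.re (p.re + δ * s) := by
      by_contra! hcon
      exact hxS ⟨hx, hcon⟩
    have h5 := hsmall e heK (by linarith [habs _ hx, habs' _ he])
    have h6 := h.horizontal e heK p.re (h.subset hpK).1
    rw [abs_sub_comm, abs_of_nonneg (by linarith [he.1])] at h6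
    have h7 := norm_sub_norm_le (f (p.re + e.im * I)) (f e)
    have h8 : M * (e.re - p.re) ≤ M * (δ * s) :=
      mul_le_mul_of_nonneg_left (by linarith [he.2]) hM
    linarith
  · have h5 : |x - p.im| ≤ s := by
      rw [abs_le]; constructor <;> linarith [hx.1, hx.2, hp.1, hp.2]
    have h8 := hsmall p hpK (by linarith [habs _ hp])
    have h6 := h.vertical p hpK x ⟨by linarith [hx.1], by linarith [hx.2]⟩
    have h7 := norm_sub_norm_le (f (p.re + x * I)) (f p)
    have h9 : M * |x - p.im| ≤ M * s := mul_le_mul_of_nonneg_left h5 hM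
    linarith
  · have : (3 + M) * δ * s * (b - a) ≤ (3 + M) * δ * s * s :=
      mul_le_mul_of_nonneg_left hbs (by positivity)
    linarith

/-- At a density point of `K` where the derivatives of `f` vanish, boundary integrals over
rectangles of size `s` are `o(s ^ 2)`. -/
theorem Portion.rectInt_isLittleO_of_zero (h : Portion f K A B C D M) {z : ℂ} (hzK : z ∈ K)
    (hdens : IsDensityPoint K z) (hL : HasFDerivWithinAt f (0 : ℂ →L[ℝ] ℂ) K z)
    (hfz : f z = 0) {ε : ℝ} (hε : 0 < ε) :
    ∃ r > 0, ∀ a b c d s : ℝ, A ≤ a → b ≤ B → C ≤ c → d ≤ D → z ∈ Icc a b ×ℂ Icc c d →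
      0 < s → s < r → b - a ≤ s → d - c ≤ s → ‖rectInt f a b c d‖ ≤ ε * s ^ 2 := by
  have hM := h.nonneg
  -- Each of the four sides of the hull contributes `(6 + 2 * M) * δ * s ^ 2`.
  obtain ⟨δ, hδ, hδ1, hδε⟩ : ∃ δ : ℝ, 0 < δ ∧ δ < 1 ∧ 4 * (6 + 2 * M) * δ ≤ ε := by
    refine ⟨min (1 / 2) (ε / (4 * (6 + 2 * M))), by positivity,
      (min_le_left _ _).trans_lt (by norm_num), ?_⟩
    rw [← le_div_iff₀' (by positivity)]
    exact min_le_right _ _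
  obtain ⟨r₁, hr₁, e1⟩ := mem_nhdsGT_iff_exists_Ioo_subset.1
    (hdens (δ ^ 2 / 9) (by positivity))
  have e2 := Asymptotics.isLittleO_iff.1 hL.isLittleO hδ
  obtain ⟨r₂, hr₂, e2⟩ := Metric.mem_nhdsWithin_iff.1 e2
  have hr₁ : 0 < r₁ := hr₁
  refine ⟨min (r₁ / 3) (r₂ / 3), by positivity, ?_⟩
  intro a b c d s ha hb hc hd hz hs0 hsr hab hcd
  obtain ⟨hs1, hs2⟩ := lt_min_iff.1 hsr
  replace e1 := e1 (show 3 * s ∈ Ioo 0 r₁ from ⟨by linarith, by linarith⟩)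
  have hsmall (e : ℂ) (heK : e ∈ K) (h12 : |e.re - z.re| + |e.im - z.im| ≤ 3 * s) :
      ‖f e‖ ≤ δ * (3 * s) := by
    have h3 := norm_le_abs_re_add_abs_im (e - z)
    rw [sub_re, sub_im] at h3
    have h4 := e2 ⟨by rw [mem_ball_iff_norm]; linarith, heK⟩
    simp only [mem_ofPred_eq, hfz, sub_zero, _root_.zero_apply] at h4
    exact h4.trans (mul_le_mul_of_nonneg_left (by linarith) hδ.le)
  obtain ⟨a', b', c', d', haa, hab', hbb, hcc, hcd', hdd, heq, ⟨p, hpK, hp, hp'⟩,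
    ⟨q, hqK, hq, hq'⟩, ⟨r, hrK, hr, hr'⟩, ⟨t, htK, ht, ht'⟩⟩ := h.exists_hull ha hb hc hd hzK hz
  obtain ⟨⟨hz1, hz2⟩, hz3, hz4⟩ := hz
  rw [heq]
  have hor (p : ℂ) (hpK : p ∈ K) (h1 : p.re ∈ Icc a' b') (h2 : p.im ∈ Icc c' d') :=
    h.norm_integral_horizontal_le hδ hδ1 hs0 e1 hsmall (by linarith) (by linarith) hab'
      (by linarith) ⟨by linarith, by linarith⟩ hpK h1
      (by rw [abs_le]; constructor <;> linarith [h2.1, h2.2])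
  have ver (p : ℂ) (hpK : p ∈ K) (h1 : p.re ∈ Icc a' b') (h2 : p.im ∈ Icc c' d') :=
    h.norm_integral_vertical_le hδ hδ1 hs0 e1 hsmall (by linarith) (by linarith) hcd'
      (by linarith) ⟨by linarith, by linarith⟩ hpK h2
      (by rw [abs_le]; constructor <;> linarith [h1.1, h1.2])
  subst hp hq hr ht
  refine (LoomanMenchoff.norm_rectInt_le (hor p hpK hp' (left_mem_Icc.2 hcd'))
    (hor q hqK hq' (right_mem_Icc.2 hcd')) (ver t htK (right_mem_Icc.2 hab') ht')
    (ver r hrK (left_mem_Icc.2 hab') hr')).trans ?_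
  have := mul_le_mul_of_nonneg_right hδε (sq_nonneg s)
  linarith

/-- At a density point of `K` where the Cauchy-Riemann equations hold, boundary integrals over
rectangles of size `s` are `o(s ^ 2)`. -/
theorem Portion.rectInt_isLittleO (h : Portion f K A B C D M) {z : ℂ} (hzK : z ∈ K)
    (hdens : IsDensityPoint K z) (hL : DifferentiableWithinAt ℝ f K z) {k : ℂ}
    (hre : HasDerivAt (fun t : ℝ => f (z + t)) k 0)
    (him : HasDerivAt (fun t : ℝ => f (z + t * I)) (I * k) 0) {ε : ℝ} (hε : 0 < ε) :
    ∃ r > 0, ∀ a b c d s : ℝ, A ≤ a → b ≤ B → C ≤ c → d ≤ D → z ∈ Icc a b ×ℂ Icc c d →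
      0 < s → s < r → b - a ≤ s → d - c ≤ s → ‖rectInt f a b c d‖ ≤ ε * s ^ 2 := by
  -- By the Cauchy-Riemann equations this one complex affine function has both partial derivatives
  -- of `f` at `z`, and its boundary integrals vanish.
  set ℓ : ℂ → ℂ := fun w => f z + k * (w - z) with hℓ
  have hℓd : Differentiable ℂ ℓ := by fun_prop
  set g : ℂ → ℂ := fun w => f w - ℓ w with hg
  have hgP : Portion g K A B C D (M + ‖k‖) :=
    { continuousOn := h.continuousOn.sub hℓd.continuous.continuousOn
      isCompact := h.isCompact
      subset := h.subset
      differentiableAt := fun w hw hwK => (h.differentiableAt w hw hwK).sub (hℓd w)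
      nonneg := add_nonneg h.nonneg (norm_nonneg _)
      horizontal := fun e he x hx => by
        have h1 : g (x + e.im * I) - g e =
            (f (x + e.im * I) - f e) - k * ((x - e.re : ℝ) : ℂ) := by
          simp only [hg, hℓ]
          conv_lhs => enter [2, 2, 2, 2, 1]; rw [← re_add_im e]
          push_cast
          ring
        rw [h1, add_mul]
        refine (norm_sub_le _ _).trans (add_le_add (h.horizontal e he x hx) ?_)
        rw [norm_mul, norm_real, Real.norm_eq_abs]
      vertical := fun e he y hy => by
        have h1 : g (e.re + y * I) - g e =
            (f (e.re + y * I) - f e) - k * ((y - e.im : ℝ) : ℂ) * I := by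
          simp only [hg, hℓ]
          conv_lhs => enter [2, 2, 2, 2, 1]; rw [← re_add_im e]
          push_cast
          ring
        rw [h1, add_mul]
        refine (norm_sub_le _ _).trans (add_le_add (h.vertical e he y hy) ?_)
        rw [norm_mul, norm_mul, norm_real, norm_I, mul_one, Real.norm_eq_abs] }
  have hgz : g z = 0 := by simp [hg, hℓ]
  have hof : HasDerivAt (fun t : ℝ => (t : ℂ)) 1 0 := ofRealCLM.hasDerivAt (x := 0)
  have hgre : HasDerivAt (fun t : ℝ => g (z + t)) 0 0 := by
    have h1 : HasDerivAt (fun t : ℝ => ℓ (z + t)) k 0 := by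
      have := (hof.const_mul k).const_add (f z)
      simpa [hℓ] using this
    simpa using! hre.sub h1
  have hgim : HasDerivAt (fun t : ℝ => g (z + t * I)) 0 0 := by
    have h1 : HasDerivAt (fun t : ℝ => ℓ (z + t * I)) (I * k) 0 := by
      have := ((hof.mul_const I).const_mul k).const_add (f z)
      simpa [hℓ, mul_comm] using this
    simpa using! him.sub h1
  have hgL : DifferentiableWithinAt ℝ g K z :=
    hL.sub (hℓd.restrictScalars ℝ z).differentiableWithinAt
  have hgL' := hgL.hasFDerivWithinAt
  rw [hgP.fderivWithin_eq_zero hzK hdens hgL' hgz hgre hgim] at hgL'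
  obtain ⟨r, hr, H⟩ := hgP.rectInt_isLittleO_of_zero hzK hdens hgL' hgz hε
  refine ⟨r, hr, fun a b c d s ha hb hc hd hz hs0 hsr hab hcd => ?_⟩
  have h1 : a ≤ b := hz.1.1.trans hz.1.2
  have h2 : c ≤ d := hz.2.1.trans hz.2.2
  have h3 := H a b c d s ha hb hc hd hz hs0 hsr hab hcd
  rwa [hg, rectInt_sub (h.continuousOn_rect ha hb hc hd) hℓd.continuous.continuousOn h1 h2,
    LoomanMenchoff.rectInt_eq_zero hℓd.continuous.continuousOn h1 h2 fun w _ => hℓd w,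
    sub_zero] at h3

/-! ### Bisection and the vanishing of the integrals. -/

/-- Induction on rectangles by repeated bisection: a property that is inherited by unions of
adjacent rectangles and holds for all small rectangles around each point, similar to the given
one, holds for the given one. -/
theorem rect_induction {P : ℝ → ℝ → ℝ → ℝ → Prop} {a b c d : ℝ} (hab : a < b) (hcd : c < d)
    (hre : ∀ a' b' c' d' m, a ≤ a' → b' ≤ b → c ≤ c' → d' ≤ d → m ∈ Icc a' b' → c' ≤ d' →
      P a' m c' d' → P m b' c' d' → P a' b' c' d')
    (him : ∀ a' b' c' d' m, a ≤ a' → b' ≤ b → c ≤ c' → d' ≤ d → a' ≤ b' → m ∈ Icc c' d' →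
      P a' b' c' m → P a' b' m d' → P a' b' c' d')
    (hloc : ∀ z ∈ Icc a b ×ℂ Icc c d, ∃ r > 0, ∀ a' b' c' d' s, a ≤ a' → b' ≤ b → c ≤ c' →
      d' ≤ d → z ∈ Icc a' b' ×ℂ Icc c' d' → 0 < s → s < r → b' - a' = (b - a) * s →
      d' - c' = (d - c) * s → P a' b' c' d') : P a b c d := by
  let J₀ : BoxIntegral.Box (Fin 2) :=
    ⟨![a, c], ![b, d], fun i => by fin_cases i <;> simp [hab, hcd]⟩
  have hsub (J : BoxIntegral.Box (Fin 2)) (hJ : J ≤ J₀) :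
      a ≤ J.lower 0 ∧ J.upper 0 ≤ b ∧ c ≤ J.lower 1 ∧ J.upper 1 ≤ d := by
    have h := BoxIntegral.Box.le_iff_bounds.1 hJ
    exact ⟨h.1 0, h.2 0, h.1 1, h.2 1⟩
  suffices h : P (J₀.lower 0) (J₀.upper 0) (J₀.lower 1) (J₀.upper 1) from h
  refine BoxIntegral.Box.subbox_induction_on'
    (p := fun J => P (J.lower 0) (J.upper 0) (J.lower 1) (J.upper 1)) J₀ ?_ ?_
  · intro J hJ hs
    obtain ⟨h1, h2, h3, h4⟩ := hsub J hJ
    have h5 := J.lower_lt_upper 0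
    have h6 := J.lower_lt_upper 1
    have s1 := hs ∅
    have s2 := hs {0}
    have s3 := hs {1}
    have s4 := hs univ
    simp only [BoxIntegral.Box.splitCenterBox, Set.piecewise, mem_empty_iff_false, if_false,
      mem_singleton_iff, mem_univ, if_true, zero_ne_one, one_ne_zero] at s1 s2 s3 s4
    have m0 : (J.lower 0 + J.upper 0) / 2 ∈ Icc (J.lower 0) (J.upper 0) :=
      ⟨by linarith, by linarith⟩
    have m1 : (J.lower 1 + J.upper 1) / 2 ∈ Icc (J.lower 1) (J.upper 1) :=
      ⟨by linarith, by linarith⟩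
    refine him _ _ _ _ _ h1 h2 h3 h4 h5.le m1 ?_ ?_
    · exact hre _ _ _ _ _ h1 h2 h3 (m1.2.trans h4) m0 m1.1 s1 s2
    · exact hre _ _ _ _ _ h1 h2 (h3.trans m1.1) h4 m0 m1.2 s3 s4
  · intro y hy
    obtain ⟨r, hr, H⟩ := hloc (y 0 + y 1 * I)
      (mk_mem_reProdIm.2 ⟨⟨hy.1 0, hy.2 0⟩, ⟨hy.1 1, hy.2 1⟩⟩)
    have hba : 0 < b - a := by linarith
    -- One coordinate suffices: the subboxes are similar to the given one, so the width determines
    -- the scale `1 / 2 ^ m`.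
    refine ⟨{w | |w 0 - y 0| < (b - a) * r / 2}, mem_nhdsWithin_of_mem_nhds
      (IsOpen.mem_nhds (isOpen_lt (by fun_prop) continuous_const) (by
        simpa using by positivity)), fun J hJ m hyJ hJU hm => ?_⟩
    obtain ⟨h1, h2, h3, h4⟩ := hsub J hJ
    have hm0 : J.upper 0 - J.lower 0 = (b - a) * (1 / 2 ^ m) := by
      rw [hm 0]; simp [J₀]; ring
    have hm1 : J.upper 1 - J.lower 1 = (d - c) * (1 / 2 ^ m) := by
      rw [hm 1]; simp [J₀]; ring
    refine H _ _ _ _ (1 / 2 ^ m) h1 h2 h3 h4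
      (mk_mem_reProdIm.2 ⟨⟨hyJ.1 0, hyJ.2 0⟩, ⟨hyJ.1 1, hyJ.2 1⟩⟩) (by positivity) ?_ hm0 hm1
    have u1 : |J.lower 0 - y 0| < (b - a) * r / 2 := hJU (left_mem_Icc.2 J.lower_le_upper)
    have u2 : |J.upper 0 - y 0| < (b - a) * r / 2 := hJU (right_mem_Icc.2 J.lower_le_upper)
    rw [abs_lt] at u1 u2
    have u3 : (b - a) * (1 / 2 ^ m) < (b - a) * r := by linarith
    exact lt_of_mul_lt_mul_left u3 hba.le

theorem measureReal_inter_reProdIm_add_re {V : Set ℂ} (hV : MeasurableSet V) {a b c d m : ℝ}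
    (hm : m ∈ Icc a b) : volume.real (V ∩ Ioc a b ×ℂ Ioc c d) =
      volume.real (V ∩ Ioc a m ×ℂ Ioc c d) + volume.real (V ∩ Ioc m b ×ℂ Ioc c d) := by
  have hfin (u v : ℝ) : volume (V ∩ Ioc u v ×ℂ Ioc c d) ≠ ⊤ :=
    (measure_lt_top_of_subset inter_subset_right (by
      rw [volume_reProdIm, Real.volume_Ioc, Real.volume_Ioc]
      exact ENNReal.mul_ne_top ENNReal.ofReal_ne_top ENNReal.ofReal_ne_top)).ne
  have hmeas : MeasurableSet (V ∩ Ioc m b ×ℂ Ioc c d) :=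
    hV.inter ((measurable_re measurableSet_Ioc).inter (measurable_im measurableSet_Ioc))
  rw [← measureReal_union ?_ hmeas (hfin _ _) (hfin _ _)]
  · congr 1
    ext w
    simp only [mem_inter_iff, mem_reProdIm, mem_union, ← Ioc_union_Ioc_eq_Ioc hm.1 hm.2]
    tauto
  · rw [Set.disjoint_left]
    rintro w ⟨_, hw⟩ ⟨_, hw'⟩
    exact absurd hw.1.2 (not_le.2 hw'.1.1)

theorem measureReal_inter_reProdIm_add_im {V : Set ℂ} (hV : MeasurableSet V) {a b c d m : ℝ}
    (hm : m ∈ Icc c d) : volume.real (V ∩ Ioc a b ×ℂ Ioc c d) =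
      volume.real (V ∩ Ioc a b ×ℂ Ioc c m) + volume.real (V ∩ Ioc a b ×ℂ Ioc m d) := by
  have hfin (u v : ℝ) : volume (V ∩ Ioc a b ×ℂ Ioc u v) ≠ ⊤ :=
    (measure_lt_top_of_subset inter_subset_right (by
      rw [volume_reProdIm, Real.volume_Ioc, Real.volume_Ioc]
      exact ENNReal.mul_ne_top ENNReal.ofReal_ne_top ENNReal.ofReal_ne_top)).ne
  have hmeas : MeasurableSet (V ∩ Ioc a b ×ℂ Ioc m d) :=
    hV.inter ((measurable_re measurableSet_Ioc).inter (measurable_im measurableSet_Ioc))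
  rw [← measureReal_union ?_ hmeas (hfin _ _) (hfin _ _)]
  · congr 1
    ext w
    simp only [mem_inter_iff, mem_reProdIm, mem_union, ← Ioc_union_Ioc_eq_Ioc hm.1 hm.2]
    tauto
  · rw [Set.disjoint_left]
    rintro w ⟨_, hw⟩ ⟨_, hw'⟩
    exact absurd hw.2.2 (not_le.2 hw'.2.1)

/-- If the Cauchy-Riemann equations hold at the points of `K`, then the integrals over the
boundaries of rectangles vanish. -/
theorem Portion.rectInt_eq_zero_of_cauchyRiemann (h : Portion f K A B C D M)
    (hCR : ∀ z ∈ K, ∃ k : ℂ, HasDerivAt (fun t : ℝ => f (z + t)) k 0 ∧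
      HasDerivAt (fun t : ℝ => f (z + t * I)) (I * k) 0) {a b c d : ℝ} (ha : A ≤ a) (hb : b ≤ B)
    (hc : C ≤ c) (hd : d ≤ D) (hab : a < b) (hcd : c < d) : rectInt f a b c d = 0 := by
  have hM := h.nonneg
  have hba : 0 < b - a := by linarith
  have hdc : 0 < d - c := by linarith
  set N : Set ℂ := {z | ¬ (z ∈ K → IsDensityPoint K z ∧ DifferentiableWithinAt ℝ f K z)}
  have hN : volume N = 0 := by
    have := (ae_isDensityPoint h.isCompact.measurableSet).and
      (h.lipschitzOnWith.ae_differentiableWithinAt_of_mem (μ := volume))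
    rw [← compl_compl N, ← mem_ae_iff]
    filter_upwards [this] with z hz
    simpa [N] using fun hzK => ⟨hz.1 hzK, hz.2 hzK⟩
  set T := max (b - a) (d - c)
  have hT : 0 < T := lt_max_of_lt_left hba
  -- A copy scaled by `s` has sides at most `T * s`; `κ`, the same for all copies, turns its area
  -- into `(T * s) ^ 2`.
  set κ := T ^ 2 / ((b - a) * (d - c)) with hκ
  have hκ0 : 0 < κ := by positivity
  have hκT : κ * ((b - a) * (d - c)) = T ^ 2 := by rw [hκ]; field_simp
  have key (ε : ℝ) (hε : 0 < ε) :
      ‖rectInt f a b c d‖ ≤ (κ * ((b - a) * (d - c)) + 12 * M * κ) * ε := by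
    obtain ⟨V, hNV, hVo, hV⟩ := exists_isOpen_lt_of_lt N (ENNReal.ofReal ε)
      (by rw [hN]; simpa using hε)
    have hVm := hVo.measurableSet
    -- This bound is additive under bisection, the half-open rectangles being disjoint. Around
    -- points of `N` the rectangle lies in `V` and the second term pays for the crude bound; around
    -- other points of `K` the first term suffices; off `K` the integral is zero.
    suffices hP : ‖rectInt f a b c d‖ ≤ ε * κ * ((b - a) * (d - c)) +
        12 * M * κ * volume.real (V ∩ Ioc a b ×ℂ Ioc c d) by
      have h1 : volume.real (V ∩ Ioc a b ×ℂ Ioc c d) ≤ ε :=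
        ENNReal.toReal_le_of_le_ofReal hε.le ((measure_mono inter_subset_left).trans hV.le)
      have h2 := mul_le_mul_of_nonneg_left h1 (show 0 ≤ 12 * M * κ by positivity)
      linarith
    refine rect_induction (P := fun a b c d => ‖rectInt f a b c d‖ ≤
      ε * κ * ((b - a) * (d - c)) + 12 * M * κ * volume.real (V ∩ Ioc a b ×ℂ Ioc c d))
      hab hcd ?_ ?_ ?_
    · intro a' b' c' d' m ha' hb' hc' hd' hm hcd' h1 h2
      rw [rectInt_add_re (h.continuousOn_rect (by linarith) (by linarith) (by linarith)
        (by linarith)) hcd' hm, measureReal_inter_reProdIm_add_re hVm hm]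
      refine (norm_add_le _ _).trans ((add_le_add h1 h2).trans (le_of_eq ?_))
      ring
    · intro a' b' c' d' m ha' hb' hc' hd' hab' hm h1 h2
      rw [rectInt_add_im (h.continuousOn_rect (by linarith) (by linarith) (by linarith)
        (by linarith)) hab' hm, measureReal_inter_reProdIm_add_im hVm hm]
      refine (norm_add_le _ _).trans ((add_le_add h1 h2).trans (le_of_eq ?_))
      ring
    · intro z hz
      have hsz {a' b' c' d' s : ℝ} (hs : 0 < s) (h1 : b' - a' = (b - a) * s)
          (h2 : d' - c' = (d - c) * s) : b' - a' ≤ T * s ∧ d' - c' ≤ T * s ∧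
          κ * ((b' - a') * (d' - c')) = (T * s) ^ 2 := by
        refine ⟨h1.trans_le (mul_le_mul_of_nonneg_right (le_max_left _ _) hs.le),
          h2.trans_le (mul_le_mul_of_nonneg_right (le_max_right _ _) hs.le), ?_⟩
        rw [h1, h2, mul_pow, ← hκT]
        ring
      by_cases hzN : z ∈ N
      · obtain ⟨r, hr, hrV⟩ := Metric.isOpen_iff.1 hVo z (hNV hzN)
        refine ⟨r / (2 * T), by positivity, fun a' b' c' d' s h1 h2 h3 h4 hz' hs hsr h5 h6 => ?_⟩
        obtain ⟨h7, h8, h9⟩ := hsz hs h5 h6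
        have hsr' : 2 * (T * s) < r := by
          rw [lt_div_iff₀ (by positivity)] at hsr
          linarith
        have hab' : a' ≤ b' := hz'.1.1.trans hz'.1.2
        have hcd' : c' ≤ d' := hz'.2.1.trans hz'.2.2
        have hsubV : Ioc a' b' ×ℂ Ioc c' d' ⊆ V := by
          intro w hw
          apply hrV
          rw [mem_ball_iff_norm]
          have h10 := norm_le_abs_re_add_abs_im (w - z)
          rw [sub_re, sub_im] at h10
          have h11 : |w.re - z.re| ≤ T * s := by
            rw [abs_le]; constructor <;> linarith [hw.1.1, hw.1.2, hz'.1.1, hz'.1.2]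
          have h12 : |w.im - z.im| ≤ T * s := by
            rw [abs_le]; constructor <;> linarith [hw.2.1, hw.2.2, hz'.2.1, hz'.2.2]
          linarith
        have hvol : volume.real (V ∩ Ioc a' b' ×ℂ Ioc c' d') = (b' - a') * (d' - c') := by
          rw [inter_eq_self_of_subset_right hsubV, measureReal_def, volume_reProdIm,
            Real.volume_Ioc, Real.volume_Ioc, ENNReal.toReal_mul,
            ENNReal.toReal_ofReal (by linarith), ENNReal.toReal_ofReal (by linarith)]
        have h10 := h.norm_rectInt_le (ha.trans h1) (h2.trans hb) (hc.trans h3) (h4.trans hd)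
          hab' hcd' h7 h8
        rw [hvol, mul_assoc ε, mul_assoc (12 * M), h9]
        have : 0 ≤ ε * (T * s) ^ 2 := by positivity
        linarith
      · by_cases hzK : z ∈ K
        · obtain ⟨hdens, hdiff⟩ : IsDensityPoint K z ∧ DifferentiableWithinAt ℝ f K z :=
            not_not.1 hzN hzK
          obtain ⟨k, hk1, hk2⟩ := hCR z hzK
          obtain ⟨r, hr, H⟩ := h.rectInt_isLittleO hzK hdens hdiff hk1 hk2 hε
          refine ⟨r / T, by positivity, fun a' b' c' d' s h1 h2 h3 h4 hz' hs hsr h5 h6 => ?_⟩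
          obtain ⟨h7, h8, h9⟩ := hsz hs h5 h6
          rw [lt_div_iff₀ hT] at hsr
          have h10 := H a' b' c' d' (T * s) (ha.trans h1) (h2.trans hb) (hc.trans h3)
            (h4.trans hd) hz' (by positivity) (by linarith) h7 h8
          rw [mul_assoc ε, h9]
          have : 0 ≤ 12 * M * κ * volume.real (V ∩ Ioc a' b' ×ℂ Ioc c' d') := by positivity
          linarith
        · obtain ⟨r, hr, hrK⟩ := Metric.isOpen_iff.1 h.isCompact.isClosed.isOpen_compl z hzK
          refine ⟨r / (2 * T), by positivity,
            fun a' b' c' d' s h1 h2 h3 h4 hz' hs hsr h5 h6 => ?_⟩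
          obtain ⟨h7, h8, h9⟩ := hsz hs h5 h6
          have hsr' : 2 * (T * s) < r := by
            rw [lt_div_iff₀ (by positivity)] at hsr
            linarith
          have hab' : a' ≤ b' := hz'.1.1.trans hz'.1.2
          have hcd' : c' ≤ d' := hz'.2.1.trans hz'.2.2
          rw [h.rectInt_eq_zero (ha.trans h1) (h2.trans hb) (hc.trans h3) (h4.trans hd) hab' hcd'
            fun w hw => ?_, norm_zero, mul_assoc ε, h9]
          · positivity
          · apply hrK
            rw [mem_ball_iff_norm]
            have h10 := norm_le_abs_re_add_abs_im (w - z)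
            rw [sub_re, sub_im] at h10
            have h11 : |w.re - z.re| ≤ T * s := by
              rw [abs_le]; constructor <;> linarith [hw.1.1, hw.1.2, hz'.1.1, hz'.1.2]
            have h12 : |w.im - z.im| ≤ T * s := by
              rw [abs_le]; constructor <;> linarith [hw.2.1, hw.2.2, hz'.2.1, hz'.2.2]
            linarith
  have ht : Tendsto (fun ε : ℝ => (κ * ((b - a) * (d - c)) + 12 * M * κ) * ε) (𝓝[>] 0) (𝓝 0) :=
    (Continuous.tendsto' (by fun_prop) _ _ (by simp)).mono_left nhdsWithin_le_nhds
  refine norm_le_zero_iff.1 (ge_of_tendsto ht ?_)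
  filter_upwards [self_mem_nhdsWithin] with ε hε using key ε hε

/-! ### Morera's theorem, the Baire argument and Looman-Menchoff. -/

/-- Morera's theorem for a rectangle. -/
theorem differentiableOn_ball_of_rectInt_eq_zero {z : ℂ} {r : ℝ}
    (hf : ContinuousOn f (Metric.ball z r))
    (h : ∀ a b c d : ℝ, a < b → c < d → Icc a b ×ℂ Icc c d ⊆ Metric.ball z r →
      rectInt f a b c d = 0) : DifferentiableOn ℂ f (Metric.ball z r) := by
  refine (IsConservativeOn.isExactOn_ball hf ?_).differentiableOn Metric.isOpen_ball
  intro u w huw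
  rw [← add_eq_zero_iff_eq_neg, wedgeIntegral_add_wedgeIntegral_eq]
  change rectInt f u.re w.re u.im w.im = 0
  change uIcc u.re w.re ×ℂ uIcc u.im w.im ⊆ _ at huw
  rcases lt_trichotomy u.re w.re with h1 | h1 | h1
  · rw [uIcc_of_lt h1] at huw
    rcases lt_trichotomy u.im w.im with h2 | h2 | h2
    · exact h _ _ _ _ h1 h2 (by rwa [uIcc_of_lt h2] at huw)
    · simp [rectInt, h2]
    · rw [rectInt_swap_im, h _ _ _ _ h1 h2 (by rwa [uIcc_of_gt h2] at huw), neg_zero]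
  · simp [rectInt, h1]
  · rw [uIcc_of_gt h1] at huw
    rw [rectInt_swap_re, neg_eq_zero]
    rcases lt_trichotomy u.im w.im with h2 | h2 | h2
    · exact h _ _ _ _ h1 h2 (by rwa [uIcc_of_lt h2] at huw)
    · simp [rectInt, h2]
    · rw [rectInt_swap_im, h _ _ _ _ h1 h2 (by rwa [uIcc_of_gt h2] at huw), neg_zero]

variable {U : Set ℂ}

/-- The complement is open: both `z + v ∈ U` and the strict reverse inequality persist near `z`.
This is why membership in `U` is a premise of the condition. -/
theorem isClosed_setOf_norm_increment_le (hU : IsOpen U) (hf : ContinuousOn f U) {E : Set ℂ}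
    (hE : E ⊆ U) (v : ℂ) (L : ℝ) :
    IsClosed {z : E | (z : ℂ) + v ∈ U → ‖f (z + v) - f z‖ ≤ L} := by
  rw [← isOpen_compl_iff, isOpen_iff_mem_nhds]
  intro z hz
  obtain ⟨hzU, hzL⟩ : (z : ℂ) + v ∈ U ∧ L < ‖f (z + v) - f z‖ := by simpa using hz
  have h1 : ContinuousAt f ((z : ℂ) + v) := hf.continuousAt (hU.mem_nhds hzU)
  have h2 : ContinuousAt f (z : ℂ) := hf.continuousAt (hU.mem_nhds (hE z.2))
  have h3 : ContinuousAt (fun w : E => (w : ℂ) + v) z := by fun_prop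
  have h4 : ContinuousAt (fun w : E => ‖f (w + v) - f w‖) z :=
    ((ContinuousAt.comp (f := fun w : E => (w : ℂ) + v) h1 h3).sub
      (ContinuousAt.comp (f := fun w : E => (w : ℂ)) h2 continuousAt_subtype_val)).norm
  filter_upwards [h3.eventually (hU.mem_nhds hzU), h4.eventually (lt_mem_nhds hzL)] with w hw hw'
  simpa using ⟨hw, hw'⟩

theorem exists_norm_increment_le {g : ℝ → ℂ} {k : ℂ} (hg : HasDerivAt g k 0) :
    ∃ n₀ : ℕ, ∀ n ≥ n₀, ∀ t : ℝ, |t| ≤ 1 / (n + 1) → ‖g t - g 0‖ ≤ n * |t| := by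
  obtain ⟨c, hc⟩ := hg.hasFDerivAt.isBigO_sub.bound
  obtain ⟨r, hr, H⟩ := Metric.eventually_nhds_iff.1 hc
  obtain ⟨n₁, hn₁⟩ := exists_nat_one_div_lt hr
  obtain ⟨n₂, hn₂⟩ := exists_nat_ge c
  refine ⟨max n₁ n₂, fun n hn t ht => ?_⟩
  have h1 : (n₁ : ℝ) ≤ n := by exact_mod_cast (le_max_left _ _).trans hn
  have h2 : (n₂ : ℝ) ≤ n := by exact_mod_cast (le_max_right _ _).trans hn
  have h3 : (1 : ℝ) / (n + 1) ≤ 1 / (n₁ + 1) := one_div_le_one_div_of_le (by positivity) (by linarith)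
  have h4 := H (y := t) (by rw [dist_zero_right, Real.norm_eq_abs]; linarith)
  rw [sub_zero, Real.norm_eq_abs] at h4
  exact h4.trans (mul_le_mul_of_nonneg_right (hn₂.trans h2) (abs_nonneg t))

theorem reProdIm_subset_ball {z : ℂ} {r : ℝ} (hr : 0 < r) :
    Icc (z.re - r / 3) (z.re + r / 3) ×ℂ Icc (z.im - r / 3) (z.im + r / 3) ⊆ Metric.ball z r := by
  intro w hw
  rw [mem_ball_iff_norm]
  have h1 := norm_le_abs_re_add_abs_im (w - z)
  rw [sub_re, sub_im] at h1
  have h2 : |w.re - z.re| ≤ r / 3 := by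
    rw [abs_le]; constructor <;> linarith [hw.1.1, hw.1.2]
  have h3 : |w.im - z.im| ≤ r / 3 := by
    rw [abs_le]; constructor <;> linarith [hw.2.1, hw.2.2]
  linarith

/-- **The Looman-Menchoff theorem**: a continuous function on an open set with partial derivatives
that satisfy the Cauchy-Riemann equations at each point is holomorphic. -/
theorem differentiableOn_of_cauchyRiemann (hU : IsOpen U) (hf : ContinuousOn f U)
    (hCR : ∀ z ∈ U, ∃ k : ℂ, HasDerivAt (fun t : ℝ => f (z + t)) k 0 ∧
      HasDerivAt (fun t : ℝ => f (z + t * I)) (I * k) 0) : DifferentiableOn ℂ f U := by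
  set G : Set ℂ := {z | ∀ᶠ w in 𝓝 z, DifferentiableAt ℂ f w}
  have hG : IsOpen G := isOpen_setOfPred_eventually_nhds
  suffices hUG : U ⊆ G from fun z hz => (hUG hz).self_of_nhds.differentiableWithinAt
  by_contra hUG
  obtain ⟨z₁, hz₁U, hz₁G⟩ := not_subset.1 hUG
  set E : Set ℂ := U ∩ Gᶜ
  have hEU : E ⊆ U := inter_subset_left
  -- `E` is closed only relative to `U`; local closedness makes it locally compact, hence a Baire
  -- space.
  have hElc : IsLocallyClosed E := hU.isLocallyClosed.inter hG.isClosed_compl.isLocallyClosed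
  have : LocallyCompactSpace E := hElc.locallyCompactSpace
  have : Nonempty E := ⟨⟨z₁, hz₁U, hz₁G⟩⟩
  set S : ℕ → Set E := fun n => {z : E | ∀ t : ℝ, |t| ≤ 1 / (n + 1) →
    ((z : ℂ) + t ∈ U → ‖f (z + t) - f z‖ ≤ n * |t|) ∧
    ((z : ℂ) + t * I ∈ U → ‖f (z + t * I) - f z‖ ≤ n * |t|)} with hS
  have hSc (n : ℕ) : IsClosed (S n) := by
    simp only [hS, ofPred_forall, ofPred_and]
    exact isClosed_iInter fun t => isClosed_iInter fun _ =>
      (isClosed_setOf_norm_increment_le hU hf hEU _ _).inter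
        (isClosed_setOf_norm_increment_le hU hf hEU _ _)
  have hSU : ⋃ n, S n = univ := by
    refine eq_univ_of_forall fun z => ?_
    obtain ⟨k, hk1, hk2⟩ := hCR z (hEU z.2)
    obtain ⟨n₁, h1⟩ := exists_norm_increment_le hk1
    obtain ⟨n₂, h2⟩ := exists_norm_increment_le hk2
    refine mem_iUnion.2 ⟨max n₁ n₂, fun t ht => ⟨fun _ => ?_, fun _ => ?_⟩⟩
    · simpa using h1 _ (le_max_left _ _) t ht
    · simpa using h2 _ (le_max_right _ _) t ht
  obtain ⟨n, z₀, hz₀⟩ := nonempty_interior_of_iUnion_of_closed hSc hSU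
  obtain ⟨r₁, hr₁, hr₁S⟩ := Metric.mem_nhds_iff.1 (mem_interior_iff_mem_nhds.1 hz₀)
  obtain ⟨r₂, hr₂, hr₂U⟩ := Metric.isOpen_iff.1 hU z₀ (hEU z₀.2)
  have hn : (0 : ℝ) < 1 / (n + 1) := by positivity
  -- Two points of the square `Q` of half-side `r / 3` differ by at most `2 * r / 3 ≤ 1 / (n + 1)`
  -- in each coordinate, so the increment bounds apply across all of `Q`.
  set r := min (min r₁ r₂) (1 / (n + 1))
  have hr : 0 < r := by positivity
  have hrr₁ : r ≤ r₁ := (min_le_left _ _).trans (min_le_left _ _)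
  have hrr₂ : r ≤ r₂ := (min_le_left _ _).trans (min_le_right _ _)
  have hrn : r ≤ 1 / (n + 1) := min_le_right _ _
  have hQU : Icc ((z₀ : ℂ).re - r / 3) ((z₀ : ℂ).re + r / 3) ×ℂ
      Icc ((z₀ : ℂ).im - r / 3) ((z₀ : ℂ).im + r / 3) ⊆ U :=
    (reProdIm_subset_ball hr).trans ((Metric.ball_subset_ball hrr₂).trans hr₂U)
  set Q : Set ℂ := Icc ((z₀ : ℂ).re - r / 3) ((z₀ : ℂ).re + r / 3) ×ℂ
    Icc ((z₀ : ℂ).im - r / 3) ((z₀ : ℂ).im + r / 3) with hQ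
  have hKS (e : ℂ) (he : e ∈ Q ∩ Gᶜ) : ∃ heE : e ∈ E, (⟨e, heE⟩ : E) ∈ S n := by
    have heE : e ∈ E := ⟨hQU he.1, he.2⟩
    exact ⟨heE, hr₁S (Metric.ball_subset_ball hrr₁ (reProdIm_subset_ball hr he.1))⟩
  have hP : Portion f (Q ∩ Gᶜ) ((z₀ : ℂ).re - r / 3) ((z₀ : ℂ).re + r / 3)
      ((z₀ : ℂ).im - r / 3) ((z₀ : ℂ).im + r / 3) n :=
    { continuousOn := hf.mono hQU
      isCompact := (isCompact_Icc.reProdIm isCompact_Icc).inter_right hG.isClosed_compl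
      subset := inter_subset_left
      differentiableAt := fun z hz hzK => by
        have : z ∈ G := by_contra fun h => hzK ⟨hz, h⟩
        exact this.self_of_nhds
      nonneg := Nat.cast_nonneg n
      horizontal := fun e he x hx => by
        obtain ⟨heE, heS⟩ := hKS e he
        have h1 : e + ((x - e.re : ℝ) : ℂ) = x + e.im * I := by apply Complex.ext <;> simp
        have h2 := (heS (x - e.re) (by
          rw [abs_le]; constructor <;> linarith [hx.1, hx.2, he.1.1.1, he.1.1.2])).1
        simp only [h1] at h2
        exact h2 (hQU (mk_mem_reProdIm.2 ⟨hx, he.1.2⟩))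
      vertical := fun e he y hy => by
        obtain ⟨heE, heS⟩ := hKS e he
        have h1 : e + ((y - e.im : ℝ) : ℂ) * I = e.re + y * I := by apply Complex.ext <;> simp
        have h2 := (heS (y - e.im) (by
          rw [abs_le]; constructor <;> linarith [hy.1, hy.2, he.1.2.1, he.1.2.2])).2
        simp only [h1] at h2
        exact h2 (hQU (mk_mem_reProdIm.2 ⟨he.1.1, hy⟩)) }
  have hball : Metric.ball (z₀ : ℂ) (r / 3) ⊆ Q := fun w hw => by
    rw [mem_ball_iff_norm] at hw
    have h1 := abs_le.1 ((abs_re_le_norm (w - z₀)).trans hw.le)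
    have h2 := abs_le.1 ((abs_im_le_norm (w - z₀)).trans hw.le)
    rw [sub_re] at h1
    rw [sub_im] at h2
    exact ⟨⟨by linarith, by linarith⟩, ⟨by linarith, by linarith⟩⟩
  have hdiff : DifferentiableOn ℂ f (Metric.ball (z₀ : ℂ) (r / 3)) := by
    refine differentiableOn_ball_of_rectInt_eq_zero (hf.mono (hball.trans hQU))
      fun a b c d hab hcd hsub => ?_
    have h1 := hball (hsub (mk_mem_reProdIm.2 ⟨left_mem_Icc.2 hab.le, left_mem_Icc.2 hcd.le⟩))
    have h2 := hball (hsub (mk_mem_reProdIm.2 ⟨right_mem_Icc.2 hab.le, right_mem_Icc.2 hcd.le⟩))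
    rw [hQ, mk_mem_reProdIm] at h1 h2
    exact hP.rectInt_eq_zero_of_cauchyRiemann (fun z hz => hCR z (hQU hz.1)) h1.1.1 h2.1.2
      h1.2.1 h2.2.2 hab hcd
  -- Holomorphy near `z₀` puts it in `G`, although it was chosen in the complement.
  refine z₀.2.2 ?_
  filter_upwards [Metric.ball_mem_nhds (z₀ : ℂ) (show 0 < r / 3 by positivity)] with w hw
  exact hdiff.differentiableAt (Metric.isOpen_ball.mem_nhds hw)

end LoomanMenchoff

/-! ### Descent to a holomorphic function of `ξ₁`. -/

namespace GMonogenic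

/-- The functional `f₁` on `E₃` in the coordinates `(x, y, z)`. -/
noncomputable def xi (a₁ b₁ : ℂ) : EuclideanSpace ℝ (Fin 3) →L[ℝ] ℂ :=
  LinearMap.toContinuousLinearMap
    { toFun := fun p => p 0 + p 1 * a₁ + p 2 * b₁
      map_add' := fun p q => by simp; ring
      map_smul' := fun c p => by simp; ring }

theorem xi_apply (a₁ b₁ : ℂ) (p : EuclideanSpace ℝ (Fin 3)) :
    xi a₁ b₁ p = p 0 + p 1 * a₁ + p 2 * b₁ := rfl

theorem mem_lineL₁_iff {a₁ b₁ : ℂ} {p : EuclideanSpace ℝ (Fin 3)} :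
    p ∈ lineL₁ a₁ b₁ ↔ xi a₁ b₁ p = 0 := by
  rw [xi_apply, Complex.ext_iff]
  simp [lineL₁]

/-- A function of a real variable whose one-sided difference quotients in both directions have
limits `k` and `-k` is differentiable. -/
theorem hasDerivAt_of_tendsto_right {g : ℝ → ℂ} {k : ℂ}
    (h₁ : Tendsto (fun ε : ℝ => ε⁻¹ • (g ε - g 0)) (𝓝[>] 0) (𝓝 k))
    (h₂ : Tendsto (fun ε : ℝ => ε⁻¹ • (g (-ε) - g 0)) (𝓝[>] 0) (𝓝 (-k))) :
    HasDerivAt g k 0 := by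
  rw [hasDerivAt_iff_tendsto_slope_zero, ← Iio_union_Ioi, nhdsWithin_union, tendsto_sup]
  simp only [zero_add]
  refine ⟨?_, h₁⟩
  have h3 : Tendsto (fun t : ℝ => -t) (𝓝[<] 0) (𝓝[>] 0) := by
    simpa using tendsto_neg_nhdsLT (a := (0 : ℝ))
  have h4 := (h₂.comp h3).neg
  rw [neg_neg] at h4
  refine h4.congr fun t => ?_
  simp

variable {V : Type*} [NormedAddCommGroup V] [NormedSpace ℝ V]

/-- A continuous function on an open set that is convex in the direction of the kernel of a
surjective map `ℓ` to `ℂ`, with one-sided directional derivatives `ℓ v * k` in the direction of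
each vector `v`, is a holomorphic function of `ℓ`. -/
theorem exists_analyticOnNhd_comp {ℓ : V →L[ℝ] ℂ} (hℓ : Function.Surjective ℓ) {Ω : Set V}
    (hΩ : IsOpen Ω) (hconv : ∀ p ∈ Ω, ∀ q ∈ Ω, ℓ (q - p) = 0 → segment ℝ p q ⊆ Ω) {g : V → ℂ}
    (hg : ContinuousOn g Ω)
    (hd : ∀ p ∈ Ω, ∃ k : ℂ, ∀ v, Tendsto (fun ε : ℝ => ε⁻¹ • (g (p + ε • v) - g p)) (𝓝[>] 0)
      (𝓝 (ℓ v * k))) :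
    ∃ F : ℂ → ℂ, AnalyticOnNhd ℂ F (ℓ '' Ω) ∧ ∀ p ∈ Ω, g p = F (ℓ p) := by
  have hconst : ∀ p ∈ Ω, ∀ q ∈ Ω, ℓ p = ℓ q → g q = g p := by
    intro p hp q hq hpq
    have hker : ℓ (q - p) = 0 := by rw [map_sub, hpq, sub_self]
    have hseg : ∀ t ∈ Icc (0 : ℝ) 1, p + t • (q - p) ∈ Ω := fun t ht =>
      hconv p hp q hq hker (by rw [segment_eq_image']; exact ⟨t, ht, rfl⟩)
    -- A continuous function on an interval with right derivative zero is constant, so one-sided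
    -- limits suffice.
    have h := constant_of_has_deriv_right_zero (f := fun t : ℝ => g (p + t • (q - p)))
      (a := 0) (b := 1) (hg.comp (by fun_prop) hseg) (fun t ht => ?_) 1 (by simp)
    · simpa using h
    · obtain ⟨k, hk⟩ := hd _ (hseg t ⟨ht.1, ht.2.le⟩)
      have h1 := hk (q - p)
      rw [hker, zero_mul] at h1
      rw [← hasDerivWithinAt_Ioi_iff_Ici, hasDerivWithinAt_iff_tendsto_slope' (by simp)]
      have h2 : Tendsto (fun x : ℝ => x - t) (𝓝[>] t) (𝓝[>] 0) := by
        refine tendsto_nhdsWithin_iff.2 ⟨?_, ?_⟩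
        · exact (Continuous.tendsto' (by fun_prop) _ _ (by simp)).mono_left nhdsWithin_le_nhds
        · filter_upwards [self_mem_nhdsWithin] with x hx
          simpa using hx
      refine (h1.comp h2).congr fun x => ?_
      have h3 : p + t • (q - p) + (x - t) • (q - p) = p + x • (q - p) := by module
      simp only [Function.comp_apply, slope, vsub_eq_sub, h3]
  classical
  -- An arbitrary section, with no continuity: by `hconst` the choice of the preimage does not
  -- affect `F`. The value 0 off the image plays no role.
  let σ : ℂ → V := fun ξ => if h : ξ ∈ ℓ '' Ω then h.choose else 0
  have hσ : ∀ ξ ∈ ℓ '' Ω, σ ξ ∈ Ω ∧ ℓ (σ ξ) = ξ := fun ξ hξ => by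
    simp only [σ, dif_pos hξ]
    exact hξ.choose_spec
  set F : ℂ → ℂ := fun ξ => g (σ ξ)
  have hF : ∀ p ∈ Ω, g p = F (ℓ p) := fun p hp => by
    obtain ⟨h1, h2⟩ := hσ (ℓ p) ⟨p, hp, rfl⟩
    exact hconst _ h1 _ hp h2
  obtain ⟨v₁, hv₁⟩ := hℓ 1
  obtain ⟨v₂, hv₂⟩ := hℓ Complex.I
  -- A continuous linear right inverse of `ℓ`. Translated to `p`, it gives a local section through
  -- `p`, whence openness of the image and continuity of `F`.
  let τ : ℂ → V := fun w => w.re • v₁ + w.im • v₂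
  have hτc : Continuous τ := by fun_prop
  have hτ (w : ℂ) : ℓ (τ w) = w := by
    simp [τ, hv₁, hv₂]
  have hτs (p : V) (hp : p ∈ Ω) : ∀ᶠ w in 𝓝 (ℓ p), p + τ (w - ℓ p) ∈ Ω := by
    have : ContinuousAt (fun w => p + τ (w - ℓ p)) (ℓ p) := by fun_prop
    refine this.eventually (hΩ.mem_nhds ?_)
    simpa [τ] using hp
  have hFloc (p : V) (hp : p ∈ Ω) : F =ᶠ[𝓝 (ℓ p)] fun w => g (p + τ (w - ℓ p)) := by
    filter_upwards [hτs p hp] with w hw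
    rw [hF _ hw, map_add, hτ, add_sub_cancel]
  have hopen : IsOpen (ℓ '' Ω) := by
    rw [isOpen_iff_mem_nhds]
    rintro _ ⟨p, hp, rfl⟩
    filter_upwards [hτs p hp] with w hw
    exact ⟨_, hw, by rw [map_add, hτ, add_sub_cancel]⟩
  have hcont : ContinuousOn F (ℓ '' Ω) := by
    rintro _ ⟨p, hp, rfl⟩
    refine ContinuousAt.continuousWithinAt (ContinuousAt.congr ?_ (hFloc p hp).symm)
    refine ContinuousAt.comp (g := g) (f := fun w => p + τ (w - ℓ p)) ?_ (by fun_prop)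
    refine hg.continuousAt (hΩ.mem_nhds ?_)
    simpa [τ] using hp
  refine ⟨F, (LoomanMenchoff.differentiableOn_of_cauchyRiemann hopen hcont ?_).analyticOnNhd
    hopen, hF⟩
  rintro _ ⟨p, hp, rfl⟩
  obtain ⟨k, hk⟩ := hd p hp
  have hdir (v : V) : HasDerivAt (fun t : ℝ => F (ℓ p + t * ℓ v)) (ℓ v * k) 0 := by
    have h1 : HasDerivAt (fun t : ℝ => g (p + t • v)) (ℓ v * k) 0 := by
      refine hasDerivAt_of_tendsto_right (by simpa using hk v) ?_
      have := hk (-v)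
      simpa using this
    refine h1.congr_of_eventuallyEq ?_
    have h2 : ContinuousAt (fun t : ℝ => p + t • v) 0 := by fun_prop
    filter_upwards [h2.eventually (hΩ.mem_nhds (by simpa using hp))] with t ht
    rw [hF _ ht]
    simp
  refine ⟨k, ?_, ?_⟩
  · simpa [hv₁] using hdir v₁
  · simpa [hv₂] using hdir v₂

/-! ### Coordinates, products and the components of `Φ`. -/

theorem continuous_coord (i : Fin 4) : Continuous fun a : HC => coord a i := by
  have h : Isometry coordHom := AddMonoidHomClass.isometry_of_norm _ fun _ => rfl
  exact (EuclideanSpace.proj (𝕜 := ℂ) i).continuous.comp h.continuous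

theorem coord_real_smul (t : ℝ) (a : HC) (i : Fin 4) : coord (t • a) i = t • coord a i := by
  have h : t • a = (t : ℂ) • a := by
    ext1 <;> exact (Complex.real_smul (x := t))
  rw [h, map_smul]
  simp

theorem coord_add_smul (a₁ a₂ : ℂ) : coord (a₁ • e₁ + a₂ • e₂) = ![a₁, a₂, 0, 0] := by
  have h := coord.apply_symm_apply ![a₁, a₂, 0, 0]
  change coord (a₁ • e₁ + a₂ • e₂ + (0 : ℂ) • e₃ + (0 : ℂ) • e₄) = _ at h
  simpa using h

theorem coord_one : coord 1 = ![1, 1, 0, 0] := by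
  have h : (1 : HC) = ⟨1, 0, 0, 0⟩ := rfl
  funext i
  rw [h]
  fin_cases i <;> simp [coord]

theorem coord_zeta (a₁ a₂ b₁ b₂ : ℂ) (p : EuclideanSpace ℝ (Fin 3)) :
    coord (zeta a₁ a₂ b₁ b₂ p) = ![xi a₁ b₁ p, xi a₂ b₂ p, 0, 0] := by
  funext i
  rw [zeta, Fin.sum_univ_three, map_add, map_add, Pi.add_apply, Pi.add_apply, coord_real_smul,
    coord_real_smul, coord_real_smul]
  change p 0 • coord 1 i + p 1 • coord (a₁ • e₁ + a₂ • e₂) i +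
    p 2 • coord (b₁ • e₁ + b₂ • e₂) i = _
  rw [coord_one, coord_add_smul, coord_add_smul]
  fin_cases i <;> simp [xi_apply]

theorem f₁_eq (a : HC) : f₁ a = coord a 0 + coord a 2 := rfl

theorem f₁_zeta (a₁ a₂ b₁ b₂ : ℂ) (p : EuclideanSpace ℝ (Fin 3)) :
    f₁ (zeta a₁ a₂ b₁ b₂ p) = xi a₁ b₁ p := by
  simp [f₁_eq, coord_zeta]

/-- This and the next two formulas are entries of the product of the matrices with rows `(c₁, c₃)`
and `(c₄, c₂)`. -/
theorem coord_mul_zero (a b : HC) :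
    coord (a * b) 0 = coord a 0 * coord b 0 + coord a 2 * coord b 3 := by
  simp [coord]
  linear_combination -(a.imI * b.imI + a.imJ * b.imJ) * Complex.I_mul_I

theorem coord_mul_two (a b : HC) :
    coord (a * b) 2 = coord a 0 * coord b 2 + coord a 2 * coord b 1 := by
  simp [coord]
  linear_combination (a.imJ * b.imI - a.imI * b.imJ) * Complex.I_mul_I

theorem coord_mul_three (a b : HC) :
    coord (a * b) 3 = coord a 1 * coord b 3 + coord a 3 * coord b 0 := by
  simp [coord]
  linear_combination (a.imI * b.imJ - a.imJ * b.imI) * Complex.I_mul_I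

theorem continuous_zeta (a₁ a₂ b₁ b₂ : ℂ) : Continuous (zeta a₁ a₂ b₁ b₂) := by
  have h : Isometry coordHom := AddMonoidHomClass.isometry_of_norm _ fun _ => rfl
  rw [← h.comp_continuous_iff]
  refine (PiLp.continuous_toLp 2 _).comp (f := fun p => coord (zeta a₁ a₂ b₁ b₂ p)) ?_
  simp only [coord_zeta]
  refine continuous_pi fun i => ?_
  fin_cases i <;> simp <;> fun_prop

theorem zeta_add_smul (a₁ a₂ b₁ b₂ : ℂ) (p v : EuclideanSpace ℝ (Fin 3)) (t : ℝ) :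
    zeta a₁ a₂ b₁ b₂ (p + t • v) = zeta a₁ a₂ b₁ b₂ p + t • zeta a₁ a₂ b₁ b₂ v := by
  simp [zeta, add_smul, Finset.sum_add_distrib, Finset.smul_sum, mul_smul]

theorem mem_E₃_iff {a₁ a₂ b₁ b₂ : ℂ} {h : HC} :
    h ∈ E₃ a₁ a₂ b₁ b₂ ↔ ∃ v, zeta a₁ a₂ b₁ b₂ v = h := by
  rw [E₃, Submodule.mem_span_range_iff_exists_fun]
  exact ⟨fun ⟨c, hc⟩ => ⟨WithLp.toLp 2 c, hc⟩, fun ⟨v, hv⟩ => ⟨v, hv⟩⟩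

/-- A component of a map on `Ω_ζ` with directional derivatives `f₁ h * k` along `E₃` is an
analytic function of `ξ₁ = f₁ ζ`. -/
theorem exists_analyticOnNhd_coord {a₁ a₂ b₁ b₂ : ℂ}
    (hf₁ : f₁ '' (E₃ a₁ a₂ b₁ b₂ : Set HC) = Set.univ)
    {Ω : Set (EuclideanSpace ℝ (Fin 3))} (hΩ_open : IsOpen Ω)
    (hΩ_convex : ConvexInDirection Ω (lineL₁ a₁ b₁)) {Φ : HC → HC}
    (hΦ : ContinuousOn Φ (domainZeta a₁ a₂ b₁ b₂ Ω)) (i : Fin 4)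
    (hd : ∀ ζ ∈ domainZeta a₁ a₂ b₁ b₂ Ω, ∃ k : ℂ, ∀ v, ∃ c : HC,
      coord c i = xi a₁ b₁ v * k ∧ Tendsto (fun ε : ℝ =>
        ε⁻¹ • (Φ (ζ + ε • zeta a₁ a₂ b₁ b₂ v) - Φ ζ)) (𝓝[>] 0) (𝓝 c)) :
    ∃ F : ℂ → ℂ, AnalyticOnNhd ℂ F (f₁ '' domainZeta a₁ a₂ b₁ b₂ Ω) ∧
      ∀ ζ ∈ domainZeta a₁ a₂ b₁ b₂ Ω, coord (Φ ζ) i = F (f₁ ζ) := by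
  have himage : f₁ '' domainZeta a₁ a₂ b₁ b₂ Ω = xi a₁ b₁ '' Ω := by
    rw [domainZeta, image_image]
    exact image_congr fun p _ => f₁_zeta _ _ _ _ p
  have hsurj : Function.Surjective (xi a₁ b₁) := fun w => by
    obtain ⟨h, hh, rfl⟩ : w ∈ f₁ '' (E₃ a₁ a₂ b₁ b₂ : Set HC) := hf₁ ▸ mem_univ w
    obtain ⟨v, rfl⟩ := mem_E₃_iff.1 hh
    exact ⟨v, (f₁_zeta _ _ _ _ v).symm⟩
  obtain ⟨F, hF, hF'⟩ := exists_analyticOnNhd_comp hsurj hΩ_open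
    (fun p hp q hq hpq => hΩ_convex p hp q hq (mem_lineL₁_iff.2 hpq))
    (g := fun p => coord (Φ (zeta a₁ a₂ b₁ b₂ p)) i)
    ((continuous_coord i).comp_continuousOn
      (hΦ.comp (continuous_zeta _ _ _ _).continuousOn (mapsTo_image _ _)))
    (fun p hp => by
      obtain ⟨k, hk⟩ := hd _ (mem_image_of_mem _ hp)
      refine ⟨k, fun v => ?_⟩
      obtain ⟨c, hc, ht⟩ := hk v
      rw [← hc]
      refine (((continuous_coord i).tendsto c).comp ht).congr fun ε => ?_
      simp only [Function.comp_apply]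
      rw [coord_real_smul, map_sub, Pi.sub_apply, zeta_add_smul])
  refine ⟨F, himage ▸ hF, ?_⟩
  rintro _ ⟨p, hp, rfl⟩
  rw [f₁_zeta]
  exact hF' p hp

end GMonogenic

theorem mainTheorem7 (a₁ a₂ b₁ b₂ : ℂ)
    (hlin : LinearIndependent ℝ (triple a₁ a₂ b₁ b₂))
    (hf₁ : f₁ '' (E₃ a₁ a₂ b₁ b₂ : Set HC) = Set.univ)
    (hf₂ : f₂ '' (E₃ a₁ a₂ b₁ b₂ : Set HC) = Set.univ)
    (Ω : Set (EuclideanSpace ℝ (Fin 3))) (hΩ_open : IsOpen Ω) (hΩ_conn : IsConnected Ω)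
    (hΩ_convex : ConvexInDirection Ω (lineL₁ a₁ b₁)) :
    (∀ Φ : HC → HC,
      RightGMonogenicOn (E₃ a₁ a₂ b₁ b₂) Φ (domainZeta a₁ a₂ b₁ b₂ Ω) →
      (∀ ζ ∈ domainZeta a₁ a₂ b₁ b₂ Ω, Φ ζ ∈ idealI₂) →
      ∃ F₂₁ F₂₃ : ℂ → ℂ,
        AnalyticOnNhd ℂ F₂₁ (f₁ '' domainZeta a₁ a₂ b₁ b₂ Ω) ∧
        AnalyticOnNhd ℂ F₂₃ (f₁ '' domainZeta a₁ a₂ b₁ b₂ Ω) ∧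
        ∀ ζ ∈ domainZeta a₁ a₂ b₁ b₂ Ω, Φ ζ = F₂₁ (f₁ ζ) • e₁ + F₂₃ (f₁ ζ) • e₃) ∧
    (∀ Φ : HC → HC,
      LeftGMonogenicOn (E₃ a₁ a₂ b₁ b₂) Φ (domainZeta a₁ a₂ b₁ b₂ Ω) →
      (∀ ζ ∈ domainZeta a₁ a₂ b₁ b₂ Ω, Φ ζ ∈ idealHatI₂) →
      ∃ F₂₂ F₂₄ : ℂ → ℂ,
        AnalyticOnNhd ℂ F₂₂ (f₁ '' domainZeta a₁ a₂ b₁ b₂ Ω) ∧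
        AnalyticOnNhd ℂ F₂₄ (f₁ '' domainZeta a₁ a₂ b₁ b₂ Ω) ∧
        ∀ ζ ∈ domainZeta a₁ a₂ b₁ b₂ Ω, Φ ζ = F₂₂ (f₁ ζ) • e₁ + F₂₄ (f₁ ζ) • e₄) := by
  constructor
  · rintro Φ ⟨hc, hd⟩ hI
    obtain ⟨F, hF, hF'⟩ := exists_analyticOnNhd_coord hf₁ hΩ_open hΩ_convex hc 0 fun ζ hζ => by
      obtain ⟨Φ', hΦ'⟩ := hd ζ hζ
      -- The factor `h` is diagonal, so only the first term of the product formula survives.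
      refine ⟨coord Φ' 0, fun v => ⟨_, ?_, hΦ' _ (mem_E₃_iff.2 ⟨v, rfl⟩)⟩⟩
      simp [coord_mul_zero, coord_zeta]
    obtain ⟨G, hG, hG'⟩ := exists_analyticOnNhd_coord hf₁ hΩ_open hΩ_convex hc 2 fun ζ hζ => by
      obtain ⟨Φ', hΦ'⟩ := hd ζ hζ
      refine ⟨coord Φ' 2, fun v => ⟨_, ?_, hΦ' _ (mem_E₃_iff.2 ⟨v, rfl⟩)⟩⟩
      simp [coord_mul_two, coord_zeta]
    refine ⟨F, G, hF, hG, fun ζ hζ => ?_⟩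
    obtain ⟨l₁, l₃, h⟩ := hI ζ hζ
    have hcoord : coord (Φ ζ) = ![l₁, 0, l₃, 0] := by
      rw [← coord.apply_symm_apply ![l₁, 0, l₃, 0], h]
      change _ = coord (l₁ • e₁ + (0 : ℂ) • e₂ + l₃ • e₃ + (0 : ℂ) • e₄)
      simp
    rw [← hF' ζ hζ, ← hG' ζ hζ, hcoord]
    exact h
  · rintro Φ ⟨hc, hd⟩ hI
    obtain ⟨F, hF, hF'⟩ := exists_analyticOnNhd_coord hf₁ hΩ_open hΩ_convex hc 0 fun ζ hζ => by
      obtain ⟨Φ', hΦ'⟩ := hd ζ hζ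
      refine ⟨coord Φ' 0, fun v => ⟨_, ?_, hΦ' _ (mem_E₃_iff.2 ⟨v, rfl⟩)⟩⟩
      simp [coord_mul_zero, coord_zeta, mul_comm]
    obtain ⟨G, hG, hG'⟩ := exists_analyticOnNhd_coord hf₁ hΩ_open hΩ_convex hc 3 fun ζ hζ => by
      obtain ⟨Φ', hΦ'⟩ := hd ζ hζ
      -- With `h` on the right, the entries in the first column are scaled by `f₁ h`: coordinate 3
      -- takes the place of coordinate 2.
      refine ⟨coord Φ' 3, fun v => ⟨_, ?_, hΦ' _ (mem_E₃_iff.2 ⟨v, rfl⟩)⟩⟩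
      simp [coord_mul_three, coord_zeta, mul_comm]
    refine ⟨F, G, hF, hG, fun ζ hζ => ?_⟩
    obtain ⟨l₁, l₄, h⟩ := hI ζ hζ
    have hcoord : coord (Φ ζ) = ![l₁, 0, 0, l₄] := by
      rw [← coord.apply_symm_apply ![l₁, 0, 0, l₄], h]
      change _ = coord (l₁ • e₁ + (0 : ℂ) • e₂ + (0 : ℂ) • e₃ + l₄ • e₄)
      simp
    rw [← hF' ζ hζ, ← hG' ζ hζ, hcoord]
    exact h
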